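/- **Theorem 6.1 (Period-Two Scale Invariance).** Consider three-heap Nim with unlabeled heaps: its positions are the multisets $\{x,y,z\}$ of three non-negative integers, and a move replaces one element of the multiset by a strictly smaller non-negative integer. Let $F$ be any finite set of such positions (the forbidden positions), and let $\mathrm{Nim}-F$ be the game whose game graph is the subgraph of the game graph of Nim induced on the positions not in $F$; thus the positions in $F$ are removed, and players may not move to them. A player who has no legal move loses. A position of $\mathrm{Nim}-F$ is called a $P$-position if the previous player (the one who is not about to move) can force a win from it. Let $\pi(n)$ be the number of $P$-positions $\{x,y,z\}$ of $\mathrm{Nim}-F$, counted as multisets, with $x$, $y$ and $z$ all less than $n$. Then for every positive integer $n$ the limit $$\lim_{k\to\infty}\frac{\pi(n2^k)}{(n2^k)^2}$$ exists (as a real number) and is nonzero. -/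

import Mathlib

open Filter Topology

/-- `IsPPosition G u`: in the impartial game whose positions are the vertices of `G` and whose legal
moves from `u` to `v` are the edges `G.Adj u v` (a player who cannot move loses), the player who has
just moved to `u` (the previous player) can force a win: every move `u → v` of the opponent has a
legal answer `v → reply v` after which the previous player can again force a win. The definition is
inductive, so the win comes after finitely many moves. In particular a position without moves is a
`P`-position. -/
inductive IsPPosition {V : Type*} (G : Digraph V) : V → Prop
  | intro (u : V) (reply : ∀ v, G.Adj u v → V)
      (legal : ∀ v (h : G.Adj u v), G.Adj v (reply v h))
      (win : ∀ v (h : G.Adj u v), IsPPosition G (reply v h)) : IsPPosition G u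

/-- The game `G - F`: the subgraph of `G` induced on the vertices outside the finite set `F` of
forbidden positions. -/
def Digraph.removeForbidden {V : Type*} (G : Digraph V) (F : Finset V) :
    Digraph {v : V // v ∉ F} where
  Adj u v := G.Adj u.1 v.1

/-- The game graph of three-heap Nim with unlabeled heaps. A position is a multiset of three natural
numbers; a move replaces one heap by a strictly smaller one. -/
def nimGraph : Digraph (Sym ℕ 3) where
  Adj p q := ∃ x x' y z : ℕ, x' < x ∧
    (p : Multiset ℕ) = {x, y, z} ∧ (q : Multiset ℕ) = {x', y, z}

/-- The number of `P`-positions of `Nim - F` all of whose heaps are smaller than `n`. (The set being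
counted is finite.) -/
noncomputable def numPPositions (F : Finset (Sym ℕ 3)) (n : ℕ) : ℕ :=
  Set.ncard {p : {p : Sym ℕ 3 // p ∉ F} |
    IsPPosition (nimGraph.removeForbidden F) p ∧ ∀ a ∈ p.1, a < n}

/-! For each pair `x`, `y` there is exactly one `z = f x y` completing a `P`-position, so the game
is a table `f` whose rows are involutions and which obeys the minimal excludant rule of Nim away
from a finite cube (`exists_isNimTable`). A `P`-triple with heaps `a < m < n` is recorded as the
cell `(m, n)`: row `n` has `R = midCount f n n` cells, and column `m` has `openCount f m (m + 1)`.
Up to O(`N`) positions with a repeated heap, the quantity to estimate is the number `tripleCount f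
N` of cells in rows below `N`.

Two relations between rows and columns carry the proof. For large `n`, column `n` has exactly `n - 1
- 2 * R` cells (`openCount_add_two_mul_midCount`). And if `(m, n)` is not a cell, column `m` has at
most as many cells from row `n` on as row `n` has to the left of `m` (`openCount_le_midCount`).

If all cells of every row and every column were packed against the diagonal, counting cells by rows
and by columns would give T(2x) = 4 T(x) + O(x) for T = `tripleCount f`. In general the error is
bounded by the displacement from this arrangement (`tripleCount_double`), which is controlled by the
inversions of rows (`rowInversions`).

The inversions satisfy ∑ `rowInversions f n` / n³ < ∞ (`summable_rowInversions`). This comes from a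
Lyapunov function, a weighted sum over the cells not yet passed. Its weights come from second
differences of `log`, chosen so that one row changes it by log((N+1)/N) plus an inversion term, less
`log 2` if the row is empty (`lyapunov_succ`). It is at most log N + O(1), which leaves bounded room
for the inversions once empty rows are accounted for.

Hence |T(2x) - 4 T(x)| is summable against x⁻³. As T has increments of linear growth, averaging over
dyadic blocks gives convergence of T(n 2^k) / 4^k (`exists_tendsto_of_summable_doubling`). The limit
is positive because T(N) ≥ N²/192 eventually (`exists_sq_le_tripleCount`). -/

/-! ### From the game to a table with a minimal excludant rule. -/

section Games

/-- Winning strategies at both `u` and `v` could be played against each other: the reply at `u`,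
followed by the reply at `v`, produces the same conflict at a later position. The induction on the
strategy replaces well-foundedness of the game. -/
theorem IsPPosition.not_of_adj {V : Type*} {G : Digraph V} {u : V} (hu : IsPPosition G u) :
    ∀ v, G.Adj u v → ¬ IsPPosition G v := by
  induction hu with
  | intro u reply legal win ih =>
    intro v h hv
    cases hv with
    | intro _ reply' legal' win' =>
      exact ih v h _ (legal' _ (legal v h)) (win' _ (legal v h))

theorem isPPosition_of_forall_not {V : Type*} {G : Digraph V}
    (wf : WellFounded fun v u => G.Adj u v) (u : V)
    (hu : ∀ v, G.Adj u v → ¬ IsPPosition G v) : IsPPosition G u := by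
  induction u using wf.induction with
  | _ u ih =>
    have key : ∀ v, G.Adj u v → ∃ w, G.Adj v w ∧ IsPPosition G w := by
      intro v hv
      by_contra hcon
      push Not at hcon
      exact hu v hv (ih v hv hcon)
    choose reply legal win using key
    exact .intro u reply legal win

theorem isPPosition_iff {V : Type*} {G : Digraph V}
    (wf : WellFounded fun v u => G.Adj u v) (u : V) :
    IsPPosition G u ↔ ∀ v, G.Adj u v → ¬ IsPPosition G v :=
  ⟨fun h => h.not_of_adj, isPPosition_of_forall_not wf u⟩

/-- The three-heap position with heaps `x`, `y`, `z`. -/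
def heaps (x y z : ℕ) : Sym ℕ 3 := ⟨{x, y, z}, by simp⟩

theorem heaps_coe (x y z : ℕ) : (heaps x y z : Multiset ℕ) = {x, y, z} := rfl

theorem heaps_swap₁₂ (x y z : ℕ) : heaps x y z = heaps y x z :=
  Subtype.ext (Multiset.cons_swap x y {z})

theorem heaps_swap₂₃ (x y z : ℕ) : heaps x y z = heaps x z y :=
  Subtype.ext (congrArg (x ::ₘ ·) (Multiset.cons_swap y z 0))

theorem exists_eq_heaps (p : Sym ℕ 3) : ∃ x y z, x ≤ y ∧ y ≤ z ∧ p = heaps x y z := by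
  obtain ⟨a, b, c, h⟩ := Multiset.card_eq_three.1 p.2
  have hp : p = heaps a b c := Subtype.ext h
  rcases le_total a b with hab | hab <;> rcases le_total b c with hbc | hbc <;>
    rcases le_total a c with hac | hac
  · exact ⟨a, b, c, hab, hbc, hp⟩
  · exact ⟨a, b, c, hab, hbc, hp⟩
  · exact ⟨a, c, b, hac, hbc, by rw [hp, heaps_swap₂₃]⟩
  · exact ⟨c, a, b, hac, hab, by rw [hp, heaps_swap₂₃, heaps_swap₁₂]⟩
  · exact ⟨b, a, c, hab, hac, by rw [hp, heaps_swap₁₂]⟩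
  · exact ⟨b, c, a, hbc, hac, by rw [hp, heaps_swap₁₂, heaps_swap₂₃]⟩
  · exact ⟨b, a, c, hab, hac, by rw [hp, heaps_swap₁₂]⟩
  · exact ⟨c, b, a, hbc, hab, by rw [hp, heaps_swap₁₂, heaps_swap₂₃, heaps_swap₁₂]⟩

theorem nimGraph_adj_heaps {x y z : ℕ} {q : Sym ℕ 3} :
    nimGraph.Adj (heaps x y z) q ↔ (∃ x' < x, q = heaps x' y z) ∨ (∃ y' < y, q = heaps x y' z) ∨
      ∃ z' < z, q = heaps x y z' := by
  constructor
  · rintro ⟨a, a', b, c, ha, h, hq⟩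
    have hq' : q = heaps a' b c := Subtype.ext hq
    have hmem : a ∈ ({x, y, z} : Multiset ℕ) := by
      rw [← heaps_coe, h]; simp
    rw [heaps_coe] at h
    simp only [Multiset.insert_eq_cons, Multiset.mem_cons, Multiset.mem_singleton] at hmem
    rcases hmem with rfl | rfl | rfl
    · refine Or.inl ⟨a', ha, ?_⟩
      have : ({y, z} : Multiset ℕ) = {b, c} := (Multiset.cons_inj_right a).1 h
      rw [hq']
      exact Subtype.ext (congrArg (a' ::ₘ ·) this.symm)
    · refine Or.inr (Or.inl ⟨a', ha, ?_⟩)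
      have h2 : (a ::ₘ {x, z} : Multiset ℕ) = a ::ₘ {b, c} := (Multiset.cons_swap a x {z}).trans h
      have : ({x, z} : Multiset ℕ) = {b, c} := (Multiset.cons_inj_right a).1 h2
      rw [hq', heaps_swap₁₂ x]
      exact Subtype.ext (congrArg (a' ::ₘ ·) this.symm)
    · refine Or.inr (Or.inr ⟨a', ha, ?_⟩)
      have h1 : ({x, y, a} : Multiset ℕ) = {a, x, y} := by
        have := congrArg (fun p : Sym ℕ 3 => (p : Multiset ℕ))
          ((heaps_swap₂₃ x y a).trans (heaps_swap₁₂ x a y))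
        exact this
      have h2 : (a ::ₘ {x, y} : Multiset ℕ) = a ::ₘ {b, c} := h1.symm.trans h
      have : ({x, y} : Multiset ℕ) = {b, c} := (Multiset.cons_inj_right a).1 h2
      rw [hq', heaps_swap₂₃ x, heaps_swap₁₂ x]
      exact Subtype.ext (congrArg (a' ::ₘ ·) this.symm)
  · rintro (⟨x', hx, rfl⟩ | ⟨y', hy, rfl⟩ | ⟨z', hz, rfl⟩)
    · exact ⟨x, x', y, z, hx, rfl, rfl⟩
    · exact ⟨y, y', x, z, hy, by rw [heaps_swap₁₂]; rfl, by rw [heaps_swap₁₂]; rfl⟩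
    · exact ⟨z, z', x, y, hz, by rw [heaps_swap₂₃, heaps_swap₁₂]; rfl,
        by rw [heaps_swap₂₃, heaps_swap₁₂]; rfl⟩

theorem wellFounded_removeForbidden (F : Finset (Sym ℕ 3)) :
    WellFounded fun v u => (nimGraph.removeForbidden F).Adj u v := by
  refine Subrelation.wf ?_ (InvImage.wf (fun p : {p : Sym ℕ 3 // p ∉ F} => (p.1 : Multiset ℕ).sum)
    Nat.lt_wfRel.wf)
  rintro v u ⟨a, a', b, c, ha, h, hq⟩
  change (v.1 : Multiset ℕ).sum < (u.1 : Multiset ℕ).sum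
  rw [h, hq]
  simp
  exact ha

/-- The position with heaps `x`, `y`, `z` is a `P`-position of `Nim - F`. -/
def PTriple (F : Finset (Sym ℕ 3)) (x y z : ℕ) : Prop :=
  ∃ h : heaps x y z ∉ F, IsPPosition (nimGraph.removeForbidden F) ⟨heaps x y z, h⟩

theorem pTriple_congr {F : Finset (Sym ℕ 3)} {x y z a b c : ℕ} (h : heaps x y z = heaps a b c) :
    PTriple F x y z ↔ PTriple F a b c := by
  unfold PTriple
  simp only [h]

theorem pTriple_iff {F : Finset (Sym ℕ 3)} {x y z : ℕ} :
    PTriple F x y z ↔ heaps x y z ∉ F ∧ (∀ x' < x, ¬ PTriple F x' y z) ∧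
      (∀ y' < y, ¬ PTriple F x y' z) ∧ ∀ z' < z, ¬ PTriple F x y z' := by
  have wf := wellFounded_removeForbidden F
  constructor
  · rintro ⟨h, hP⟩
    rw [isPPosition_iff wf] at hP
    refine ⟨h, fun x' hx ⟨h', hP'⟩ => hP _ ?_ hP', fun x' hx ⟨h', hP'⟩ => hP _ ?_ hP',
      fun x' hx ⟨h', hP'⟩ => hP _ ?_ hP'⟩
    · exact nimGraph_adj_heaps.2 (Or.inl ⟨x', hx, rfl⟩)
    · exact nimGraph_adj_heaps.2 (Or.inr (Or.inl ⟨x', hx, rfl⟩))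
    · exact nimGraph_adj_heaps.2 (Or.inr (Or.inr ⟨x', hx, rfl⟩))
  · rintro ⟨h, hx, hy, hz⟩
    refine ⟨h, (isPPosition_iff wf _).2 ?_⟩
    rintro ⟨q, hq⟩ hadj hP
    rcases nimGraph_adj_heaps.1 (show nimGraph.Adj (heaps x y z) q from hadj) with
      ⟨x', hx', rfl⟩ | ⟨x', hx', rfl⟩ | ⟨x', hx', rfl⟩
    · exact hx x' hx' ⟨hq, hP⟩
    · exact hy x' hx' ⟨hq, hP⟩
    · exact hz x' hx' ⟨hq, hP⟩

theorem PTriple.unique {F : Finset (Sym ℕ 3)} {x y z z' : ℕ} (h : PTriple F x y z)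
    (h' : PTriple F x y z') : z = z' := by
  rcases lt_trichotomy z z' with hlt | rfl | hlt
  · exact absurd h ((pTriple_iff.1 h').2.2.2 z hlt)
  · rfl
  · exact absurd h' ((pTriple_iff.1 h).2.2.2 z' hlt)

theorem pTriple_swap₁₂ {F : Finset (Sym ℕ 3)} {x y z : ℕ} : PTriple F x y z ↔ PTriple F y x z :=
  pTriple_congr (heaps_swap₁₂ x y z)

theorem pTriple_swap₂₃ {F : Finset (Sym ℕ 3)} {x y z : ℕ} : PTriple F x y z ↔ PTriple F x z y :=
  pTriple_congr (heaps_swap₂₃ x y z)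

/-- All heaps of forbidden positions are smaller than some bound. -/
theorem exists_heap_bound (F : Finset (Sym ℕ 3)) :
    ∃ B, ∀ x y z, B ≤ x ∨ B ≤ y ∨ B ≤ z → heaps x y z ∉ F := by
  refine ⟨F.sup (fun p => (p : Multiset ℕ).sum) + 1, fun x y z h hF => ?_⟩
  have := Finset.le_sup (f := fun p : Sym ℕ 3 => (p : Multiset ℕ).sum) hF
  simp only [heaps_coe, Multiset.insert_eq_cons, Multiset.sum_cons, Multiset.sum_singleton] at this
  omega

/-- Pigeonhole: each of the `x + y + 1` candidates from `B` to `x + y + B` would be spoiled by a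
`P`-position with a smaller first or second heap, and by uniqueness each of the `x + y` smaller
heaps spoils at most one candidate. -/
theorem exists_pTriple_le {F : Finset (Sym ℕ 3)} {B : ℕ}
    (hB : ∀ x y z, B ≤ x ∨ B ≤ y ∨ B ≤ z → heaps x y z ∉ F) (x y : ℕ) :
    ∃ z ≤ x + y + B, PTriple F x y z := by
  by_contra! hcon
  have key : ∀ i : Fin (x + y + 1), ∃ s : Fin x ⊕ Fin y,
      Sum.elim (fun a : Fin x => PTriple F y (i + B) a) (fun b : Fin y => PTriple F x (i + B) b) s := by
    intro i
    have h1 := hcon (i + B) (by omega)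
    rw [pTriple_iff] at h1
    have hF := hB x y (i + B) (by omega)
    by_contra! hno
    refine h1 ⟨hF, fun x' hx h => hno (Sum.inl ⟨x', hx⟩) ?_,
      fun x' hx h => hno (Sum.inr ⟨x', hx⟩) ?_, fun z' hz => hcon z' (by omega)⟩
    · exact pTriple_swap₂₃.1 (pTriple_swap₁₂.1 h)
    · exact pTriple_swap₂₃.1 h
  choose s hs using key
  have hinj : Function.Injective s := by
    intro i j hij
    have hi := hs i
    have hj := hs j
    rw [← hij] at hj
    rcases hsi : s i with a | b
    · rw [hsi] at hi hj
      have := (pTriple_swap₂₃.1 hi).unique (pTriple_swap₂₃.1 hj)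
      ext; omega
    · rw [hsi] at hi hj
      have := (pTriple_swap₂₃.1 hi).unique (pTriple_swap₂₃.1 hj)
      ext; omega
  have := Fintype.card_le_of_injective s hinj
  simp at this

/-- A symmetric table on `ℕ × ℕ` whose rows are involutions, which obeys the minimal excludant rule
of Nim outside a finite cube, and which lies at bounded distance below `x + y`. -/
structure IsNimTable (f : ℕ → ℕ → ℕ) (L : ℕ) : Prop where
  symm : ∀ x y, f x y = f y x
  invol : ∀ x y, f x (f x y) = y
  mex : ∀ x y z, L ≤ x ∨ L ≤ y ∨ L ≤ z → f x y ≠ z → f y z < x ∨ f x z < y ∨ f x y < z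
  zero_left : ∀ x, L ≤ x → f 0 x = x
  le_add : ∀ x y, f x y ≤ x + y + L
  pos : 0 < L

theorem exists_isNimTable (F : Finset (Sym ℕ 3)) :
    ∃ f L, IsNimTable f L ∧ ∀ x y z, PTriple F x y z ↔ f x y = z := by
  obtain ⟨B, hB⟩ := exists_heap_bound F
  choose f hle hf using exists_pTriple_le hB
  have hiff : ∀ x y z, PTriple F x y z ↔ f x y = z :=
    fun x y z => ⟨fun h => (hf x y).unique h, fun h => h ▸ hf x y⟩
  have hsymm : ∀ x y, f x y = f y x := fun x y =>
    (hiff x y _).1 (pTriple_swap₁₂.1 (hf y x))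
  have hinvol : ∀ x y, f x (f x y) = y := fun x y =>
    (hiff x _ y).1 (pTriple_swap₂₃.1 (hf x y))
  have hmex : ∀ x y z, B ≤ x ∨ B ≤ y ∨ B ≤ z → f x y ≠ z → f y z < x ∨ f x z < y ∨ f x y < z := by
    intro x y z h hne
    by_contra! hcon
    refine hne ((hiff x y z).1 (pTriple_iff.2 ⟨hB x y z h, fun x' hx h => ?_, fun x' hx h => ?_,
      fun x' hx h => ?_⟩))
    · have := (hiff y z x').1 (pTriple_swap₂₃.1 (pTriple_swap₁₂.1 h)); omega
    · have := (hiff x z x').1 (pTriple_swap₂₃.1 h); omega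
    · have := (hiff x y x').1 h; omega
  have hrow : ∀ x, B ≤ x → f 0 x ≤ x := by
    intro x hx
    by_contra! hlt
    rcases hmex 0 x x (Or.inr (Or.inl hx)) (by omega) with h | h | h <;> omega
  -- Row `0` may pair a heap below `B` with a large one; the supremum puts `L` beyond all such
  -- partners.
  let L := B + 1 + (Finset.range B).sup (f 0)
  have hzero : ∀ x, L ≤ x → f 0 x = x := by
    intro x hx
    have hxB : B + 1 + (Finset.range B).sup (f 0) ≤ x := hx
    by_contra hne
    have h1 := hrow x (by omega)
    have hB' : f 0 x < B := by
      by_contra! hge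
      have := hrow _ hge
      rw [hinvol] at this
      omega
    have := Finset.le_sup (f := f 0) (Finset.mem_range.2 hB')
    rw [hinvol] at this
    omega
  refine ⟨f, L, ⟨hsymm, hinvol, fun x y z h => hmex x y z ?_, hzero, fun x y => ?_, ?_⟩, hiff⟩
  · have : B ≤ L := by simp only [L]; omega
    omega
  · have : B ≤ L := by simp only [L]; omega
    have := hle x y
    omega
  · simp only [L]; omega

end Games

/-! ### Counting cells in rows and columns of the table. -/

section Combinatorics

/-- Number of `i < m` with `f i n < i`: the number of `P`-triples with greatest heap `n` whose
middle heap is smaller than `m`. -/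
def midCount (f : ℕ → ℕ → ℕ) (m n : ℕ) : ℕ := ((Finset.range m).filter fun i => f i n < i).card

/-- Number of `w < m` with `n ≤ f w m`: for `m < n`, the number of `P`-triples with middle heap `m`
whose greatest heap is at least `n`. -/
def openCount (f : ℕ → ℕ → ℕ) (m n : ℕ) : ℕ := ((Finset.range m).filter fun w => n ≤ f w m).card

/-- Number of pairs `i < m < n` such that `i`, but not `m`, is the middle heap of a `P`-triple with
greatest heap `n`. -/
def rowInversions (f : ℕ → ℕ → ℕ) (n : ℕ) : ℕ :=
  ∑ m ∈ (Finset.range n).filter (fun m => ¬ f m n < m), midCount f m n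

theorem midCount_le (f : ℕ → ℕ → ℕ) (m n : ℕ) : midCount f m n ≤ m := by
  simpa [midCount] using Finset.card_filter_le (Finset.range m) fun i => f i n < i

theorem openCount_le (f : ℕ → ℕ → ℕ) (m n : ℕ) : openCount f m n ≤ m := by
  simpa [openCount] using Finset.card_filter_le (Finset.range m) fun w => n ≤ f w m

theorem midCount_mono (f : ℕ → ℕ → ℕ) {m m' : ℕ} (n : ℕ) (h : m ≤ m') :
    midCount f m n ≤ midCount f m' n :=
  Finset.card_le_card (Finset.filter_subset_filter _ (Finset.range_mono h))

namespace IsNimTable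

variable {f : ℕ → ℕ → ℕ} {L : ℕ}

theorem eq_comm_iff (hf : IsNimTable f L) {x y z : ℕ} : f x y = z ↔ f x z = y :=
  ⟨fun h => h ▸ hf.invol x y, fun h => h ▸ hf.invol x z⟩

theorem invol_right (hf : IsNimTable f L) (x y : ℕ) : f (f x y) y = x := by
  rw [hf.symm, hf.symm x, hf.invol]

theorem self_eq_zero (hf : IsNimTable f L) {x : ℕ} (hx : L ≤ x) : f x x = 0 := by
  rw [hf.eq_comm_iff, hf.symm]
  exact hf.zero_left x hx

/-- This is where `3 * L` comes from: the diagonal entry `f w w` is `0` for `w ≥ L` and at most `2 *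
w + L < 3 * L` otherwise. -/
theorem apply_ne_self (hf : IsNimTable f L) {w n : ℕ} (hn : 3 * L ≤ n) (hw : w < n) :
    f w n ≠ w := by
  intro h
  rw [hf.eq_comm_iff] at h
  rcases le_or_gt L w with hL | hL
  · rw [hf.self_eq_zero hL] at h
    omega
  · have := hf.le_add w w
    omega

/-- Row `n` is an involution without fixed points here, and `midCount` counts the larger member of
each pair. -/
theorem card_filter_lt (hf : IsNimTable f L) {c n : ℕ} (hn : 3 * L ≤ n) (hc : c ≤ n) :
    ((Finset.range c).filter fun w => f w n < c).card = 2 * midCount f c n := by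
  have h1 : (((Finset.range c).filter fun w => f w n < c).filter fun w => f w n < w)
      = (Finset.range c).filter fun w => f w n < w := by
    ext w
    simp only [Finset.mem_filter, Finset.mem_range]
    omega
  have h2 : (((Finset.range c).filter fun w => f w n < c).filter fun w => ¬ f w n < w).card
      = ((Finset.range c).filter fun w => f w n < w).card := by
    refine Finset.card_nbij' (fun w => f w n) (fun w => f w n) ?_ ?_ ?_ ?_
    · intro w hw
      simp only [Finset.coe_filter, Finset.mem_filter, Finset.mem_range, Set.mem_ofPred_eq] at hw ⊢
      rw [hf.invol_right]
      have := hf.apply_ne_self hn (show w < n by omega)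
      omega
    · intro w hw
      simp only [Finset.coe_filter, Finset.mem_filter, Finset.mem_range, Set.mem_ofPred_eq] at hw ⊢
      rw [hf.invol_right]
      omega
    · intro w _
      exact hf.invol_right w n
    · intro w _
      exact hf.invol_right w n
  rw [← Finset.card_filter_add_card_filter_not (fun w => f w n < w), h1, h2, midCount]
  omega

theorem openCount_succ (hf : IsNimTable f L) (m n : ℕ) :
    openCount f m n = openCount f m (n + 1) + if f m n < m then 1 else 0 := by
  have h1 : ((Finset.range m).filter fun w => f w m = n).card = if f m n < m then 1 else 0 := by
    have : ((Finset.range m).filter fun w => f w m = n)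
        = if f m n < m then {f m n} else ∅ := by
      ext w
      have : f w m = n ↔ f m n = w := by rw [hf.symm, hf.eq_comm_iff]
      split_ifs with h
      · simp only [Finset.mem_filter, Finset.mem_range, Finset.mem_singleton]
        omega
      · simp only [Finset.mem_filter, Finset.mem_range, Finset.notMem_empty, iff_false]
        omega
    rw [this]
    split_ifs <;> simp
  rw [← h1, openCount, openCount, ← Finset.card_union_of_disjoint]
  · congr 1
    ext w
    simp only [Finset.mem_filter, Finset.mem_range, Finset.mem_union]
    omega
  · rw [Finset.disjoint_filter]
    intros
    omega

theorem openCount_eq_zero (hf : IsNimTable f L) {m n : ℕ} (h : 2 * m + L ≤ n) :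
    openCount f m n = 0 := by
  rw [openCount, Finset.card_eq_zero, Finset.filter_eq_empty_iff]
  intro w hw
  have := hf.le_add w m
  rw [Finset.mem_range] at hw
  omega

theorem openCount_eq_card (hf : IsNimTable f L) {m n N : ℕ} (hn : n ≤ N) :
    openCount f m n = ((Finset.Ico n N).filter fun k => f m k < m).card + openCount f m N := by
  induction N, hn using Nat.le_induction with
  | base => simp
  | succ N hN ih =>
    rw [ih, hf.openCount_succ m N, Finset.card_filter, Finset.card_filter,
      Finset.sum_Ico_succ_top hN]
    omega

/-- Each `n` splits the smaller heaps into `0`, the heaps paired by row `n`, and the rest. -/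
theorem openCount_add_two_mul_midCount (hf : IsNimTable f L) {n : ℕ} (hn : 3 * L ≤ n) :
    openCount f n (n + 1) + 2 * midCount f n n + 1 = n := by
  have hL := hf.pos
  rw [← hf.card_filter_lt hn le_rfl]
  have h0 : ((Finset.range n).filter fun w => f w n = n).card = 1 := by
    rw [Finset.card_eq_one]
    refine ⟨0, ?_⟩
    ext w
    have : f w n = n ↔ w = 0 := by
      rw [hf.symm, hf.eq_comm_iff, hf.self_eq_zero (by omega)]
      exact eq_comm
    simp only [Finset.mem_filter, Finset.mem_range, Finset.mem_singleton, this]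
    omega
  have hsum : ∑ w ∈ Finset.range n, ((if n + 1 ≤ f w n then 1 else 0) + (if f w n < n then 1 else 0)
      + if f w n = n then 1 else 0) = ∑ _w ∈ Finset.range n, 1 := by
    refine Finset.sum_congr rfl fun w _ => ?_
    split_ifs <;> omega
  rw [Finset.sum_add_distrib, Finset.sum_add_distrib, ← Finset.card_filter, ← Finset.card_filter,
    ← Finset.card_filter, h0] at hsum
  simpa [openCount] using hsum

/-- If `m < n` is not the middle heap of a `P`-triple with greatest heap `n`, then row `n` has at
least as many pairs below `m` as `m` has unmatched partners. -/
theorem openCount_le_midCount (hf : IsNimTable f L) {m n : ℕ} (hn : 3 * L ≤ n) (hmn : m < n)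
    (hw : ¬ f m n < m) : openCount f m n ≤ midCount f m n := by
  have hL := hf.pos
  rcases lt_or_ge m L with hm | hm
  · rw [hf.openCount_eq_zero (by omega)]
    exact Nat.zero_le _
  -- In the minimal excludant rule for `w`, `m`, `n`, the hypotheses on `f m n` and `f w m` exclude
  -- the other two alternatives.
  have hmatch : ∀ w, w < m → n ≤ f w m → f w n < m := by
    intro w hwm hopen
    have hne : f w m ≠ n := by
      intro h
      rw [hf.symm, hf.eq_comm_iff] at h
      omega
    rcases hf.mex w m n (by omega) hne with h | h | h <;> omega
  -- If row `n` paired `w` with `v`, then `f w v = n`, and all three alternatives of the rule for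
  -- `w`, `v`, `m` would fail.
  have htri : ∀ w v, w < v → v < m → n ≤ f w m → n ≤ f v m → f w n ≠ v := by
    intro w v hwv hvm h1 h2 h
    rw [hf.eq_comm_iff] at h
    rcases hf.mex w v m (by omega) (by omega) with h' | h' | h' <;> omega
  -- Each open `w` goes to the larger member of its pair in row `n`; no pair contains two open
  -- heaps.
  refine Finset.card_le_card_of_injOn (fun w => max w (f w n)) ?_ ?_
  · intro w hw
    simp only [Finset.coe_filter, Finset.mem_range, Set.mem_ofPred_eq] at hw ⊢
    have h1 := hmatch w hw.1 hw.2
    have h2 := hf.apply_ne_self hn (show w < n by omega)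
    have h3 := hf.invol_right w n
    rcases lt_or_gt_of_ne h2 with h | h
    · rw [max_eq_left h.le]
      omega
    · rw [max_eq_right h.le, h3]
      omega
  · intro w hw v hv hwv
    simp only [Finset.coe_filter, Finset.mem_range, Set.mem_ofPred_eq] at hw hv hwv
    by_contra hne
    have h1 := hf.apply_ne_self hn (show w < n by omega)
    have h2 := hf.apply_ne_self hn (show v < n by omega)
    have h3 := hf.invol_right w n
    have h4 := hf.invol_right v n
    have hpair : f w n = v ∨ f v n = w := by
      rcases max_choice w (f w n) with e1 | e1 <;> rcases max_choice v (f v n) with e2 | e2 <;>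
        rw [e1, e2] at hwv
      · exact absurd hwv hne
      · exact Or.inr hwv.symm
      · exact Or.inl hwv
      · rw [← hwv, h3] at h4
        exact absurd h4 hne
    have hvw : f w n = v := by
      rcases hpair with h | h
      · exact h
      · rw [← h, h4]
    have hwv' : f v n = w := by rw [← hvw, h3]
    rcases lt_or_gt_of_ne hne with h | h
    · exact htri w v h hv.1 hw.2 hv.2 hvw
    · exact htri v w h hw.1 hv.2 hw.2 hwv'

theorem openCount_eq_zero_of_midCount (hf : IsNimTable f L) {m n : ℕ} (hn : 3 * L ≤ n)
    (hmn : m < n) (h0 : midCount f n n = 0) : openCount f m n = 0 := by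
  have hw : ¬ f m n < m := by
    intro h
    rw [midCount, Finset.card_eq_zero, Finset.filter_eq_empty_iff] at h0
    exact h0 (Finset.mem_range.2 hmn) h
  have h1 := hf.openCount_le_midCount hn hmn hw
  have h2 := midCount_mono f n hmn.le
  omega

theorem openCount_le_add (hf : IsNimTable f L) (m n k : ℕ) :
    openCount f m n ≤ openCount f m (n + k) + k := by
  rw [hf.openCount_eq_card (Nat.le_add_right n k)]
  have := Finset.card_filter_le (Finset.Ico n (n + k)) fun k => f m k < m
  rw [Nat.card_Ico] at this
  omega

/-- Two large heaps `n < n'` which are greatest in no `P`-triple satisfy `2 * n ≤ n'`. -/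
theorem two_mul_le_of_midCount_eq_zero (hf : IsNimTable f L) {n n' : ℕ} (hn : 3 * L ≤ n)
    (hnn : n < n') (h : midCount f n n = 0) (h' : midCount f n' n' = 0) : 2 * n ≤ n' := by
  have h1 := hf.openCount_add_two_mul_midCount hn
  have h2 := hf.openCount_eq_zero_of_midCount (by omega) hnn h'
  -- Column `n` starts with `n - 1` open cells, loses at most one per row, and must be exhausted at
  -- row `n'`.
  have h3 := hf.openCount_le_add n (n + 1) (n' - (n + 1))
  rw [show n + 1 + (n' - (n + 1)) = n' by omega] at h3
  omega

end IsNimTable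

/-- Summing over the elements violating `p` a function of their rank among such elements. -/
theorem sum_filter_not_rank {M : Type*} [AddCommMonoid M] (p : ℕ → Prop) [DecidablePred p]
    (φ : ℕ → M) (n : ℕ) :
    ∑ m ∈ (Finset.range n).filter (fun m => ¬ p m), φ (m - ((Finset.range m).filter p).card)
      = ∑ j ∈ Finset.range (n - ((Finset.range n).filter p).card), φ j := by
  induction n with
  | zero => simp
  | succ n ih =>
    have hle : ((Finset.range n).filter p).card ≤ n := by
      simpa using Finset.card_filter_le (Finset.range n) p
    rw [Finset.range_add_one, Finset.filter_insert, Finset.filter_insert]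
    by_cases h : p n
    · rw [if_neg (not_not.2 h), if_pos h, Finset.card_insert_of_notMem (by simp), ih]
      congr 2
      omega
    · rw [if_pos h, if_neg h, Finset.sum_insert (by simp), ih,
        show n + 1 - ((Finset.range n).filter p).card
          = (n - ((Finset.range n).filter p).card) + 1 by omega, Finset.sum_range_succ, add_comm]

end Combinatorics

/-! ### Logarithmic weights and their functional equation. -/

section Weights

/-- Minus the second difference of `log` at `x` (and `2` for `x ≤ 1`). -/
noncomputable def diffWeight (x : ℕ) : ℝ :=
  if x ≤ 1 then 2 else Real.log ((x : ℝ) ^ 2 / ((x : ℝ) ^ 2 - 1))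

/-- Partial sums of `diffWeight`. -/
noncomputable def diffWeightSum (x : ℕ) : ℝ := ∑ i ∈ Finset.range x, diffWeight (i + 1)

/-- The sum of two consecutive values of `diffWeight`, continued linearly to negative integers. -/
noncomputable def pairWeight (y : ℤ) : ℝ :=
  if 1 ≤ y then diffWeight y.toNat + diffWeight (y.toNat + 1)
  else diffWeight 1 + diffWeight 2 + (1 - y)

theorem diffWeight_of_two_le {x : ℕ} (hx : 2 ≤ x) :
    diffWeight x = Real.log ((x : ℝ) ^ 2 / ((x : ℝ) ^ 2 - 1)) := by
  rw [diffWeight, if_neg (by omega)]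

theorem diffWeight_one : diffWeight 1 = 2 := by simp [diffWeight]

theorem diffWeight_nonneg (x : ℕ) : 0 ≤ diffWeight x := by
  unfold diffWeight
  split_ifs with h
  · exact zero_le_two
  · have hx : (2 : ℝ) ≤ x := by exact_mod_cast (by omega : 2 ≤ x)
    apply Real.log_nonneg
    rw [le_div_iff₀ (by nlinarith)]
    linarith

/-- Quantitative decrease of `diffWeight`. -/
theorem inv_cube_le_diffWeight_sub {x : ℕ} (hx : 1 ≤ x) :
    1 / (x : ℝ) ^ 3 ≤ diffWeight x - diffWeight (x + 1) := by
  rcases hx.eq_or_lt with rfl | hx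
  -- The value `2` at `1` is large enough: any value from `1 + log (4 / 3)` on would give this case.
  · rw [diffWeight_one, diffWeight_of_two_le (by norm_num)]
    have := Real.log_le_sub_one_of_pos (show (0 : ℝ) < (((1 + 1 : ℕ) : ℝ) ^ 2 /
      (((1 + 1 : ℕ) : ℝ) ^ 2 - 1)) by norm_num)
    norm_num at this ⊢
    linarith
  · have h2 : (2 : ℝ) ≤ x := by exact_mod_cast hx
    have hx1 : (0 : ℝ) < (x : ℝ) ^ 2 - 1 := by nlinarith
    rw [diffWeight_of_two_le hx, diffWeight_of_two_le (by omega), ← Real.log_div]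
    rotate_left
    · positivity
    · push_cast
      have : (0 : ℝ) < ((x : ℝ) + 1) ^ 2 - 1 := by nlinarith
      positivity
    push_cast
    set t : ℝ := (x : ℝ)
    have hq : t ^ 2 / (t ^ 2 - 1) / ((t + 1) ^ 2 / ((t + 1) ^ 2 - 1))
        = (t ^ 3 * (t + 2)) / ((t - 1) * (t + 1) ^ 3) := by
      have e1 : (t + 1) ^ 2 - 1 = t * (t + 2) := by ring
      have e2 : t ^ 2 - 1 = (t - 1) * (t + 1) := by ring
      have : t - 1 ≠ 0 := by linarith
      have : t + 1 ≠ 0 := by linarith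
      have : t + 2 ≠ 0 := by linarith
      have : t ≠ 0 := by linarith
      rw [e1, e2]
      field_simp
    rw [hq]
    have hpos : 0 < (t ^ 3 * (t + 2)) / ((t - 1) * (t + 1) ^ 3) := by
      have : 0 < t - 1 := by linarith
      positivity
    refine le_trans ?_ (Real.one_sub_inv_le_log_of_pos hpos)
    rw [inv_div, le_sub_iff_add_le, div_add_div _ _ (by positivity) (by positivity),
      div_le_one (by positivity)]
    have : 0 ≤ t ^ 3 := by positivity
    nlinarith [mul_nonneg this (by linarith : 0 ≤ t - 1)]

theorem diffWeight_antitone : Antitone diffWeight := by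
  refine antitone_nat_of_succ_le fun x => ?_
  rcases Nat.eq_zero_or_pos x with rfl | hx
  · simp [diffWeight]
  · have := inv_cube_le_diffWeight_sub hx
    have h2 : 0 ≤ 1 / (x : ℝ) ^ 3 := by positivity
    linarith

theorem diffWeightSum_succ (x : ℕ) :
    diffWeightSum (x + 1) = diffWeightSum x + diffWeight (x + 1) :=
  Finset.sum_range_succ _ _

theorem diffWeightSum_eq {x : ℕ} (hx : 1 ≤ x) :
    diffWeightSum x = 2 + Real.log 2 - Real.log ((x + 1) / x) := by
  induction x, hx using Nat.le_induction with
  | base => simp [diffWeightSum, diffWeight_one]; norm_num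
  | succ x hx ih =>
    have h1 : (1 : ℝ) ≤ x := by exact_mod_cast hx
    rw [diffWeightSum_succ, ih, diffWeight_of_two_le (by omega)]
    push_cast
    have e : ((x : ℝ) + 1) ^ 2 / (((x : ℝ) + 1) ^ 2 - 1)
        = ((x + 1) / x) / ((x + 1 + 1) / (x + 1)) := by
      have e1 : ((x : ℝ) + 1) ^ 2 - 1 = x * (x + 1 + 1) := by ring
      rw [e1]
      field_simp
    rw [e, Real.log_div (x := (x + 1) / x) (by positivity) (by positivity)]
    ring

theorem diffWeightSum_le (x : ℕ) : diffWeightSum x ≤ 2 + Real.log 2 := by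
  rcases Nat.eq_zero_or_pos x with rfl | hx
  · have := Real.log_nonneg one_le_two
    simp only [diffWeightSum, Finset.range_zero, Finset.sum_empty]
    linarith
  · rw [diffWeightSum_eq hx]
    have h1 : (1 : ℝ) ≤ x := by exact_mod_cast hx
    have := Real.log_nonneg (show (1 : ℝ) ≤ (x + 1) / x by rw [le_div_iff₀ (by linarith)]; linarith)
    linarith

/-- The functional equation of the weights: `x ↦ 2 * x` and `x ↦ 2 * x + 1` against `x`. -/
theorem diffWeightSum_double (x : ℕ) :
    diffWeightSum (2 * x) + diffWeightSum (2 * x + 1) - diffWeightSum x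
      = 2 + if x = 0 then 0 else Real.log 2 := by
  split_ifs with h
  · subst h
    simp [diffWeightSum, diffWeight_one]
  · have hx : 1 ≤ x := by omega
    have h1 : (1 : ℝ) ≤ x := by exact_mod_cast hx
    rw [diffWeightSum_eq hx, diffWeightSum_eq (by omega), diffWeightSum_eq (by omega)]
    push_cast
    have e : ((x : ℝ) + 1) / x = ((2 * x + 1) / (2 * x)) * ((2 * x + 1 + 1) / (2 * x + 1)) := by
      field_simp
      ring
    rw [e, Real.log_mul (by positivity) (by positivity)]
    ring

theorem pairWeight_of_pos {y : ℕ} (hy : 1 ≤ y) :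
    pairWeight y = diffWeight y + diffWeight (y + 1) := by
  rw [pairWeight, if_pos (by exact_mod_cast hy), Int.toNat_natCast]

/-- The linear continuation to `y ≤ 0` drops by `1` per step, which is at least `1 / N ^ 3`. -/
theorem inv_cube_le_pairWeight_sub {y : ℤ} {N : ℕ} (hN : 1 ≤ N) (hy : y ≤ N) :
    1 / (N : ℝ) ^ 3 ≤ pairWeight y - pairWeight (y + 1) := by
  have hN' : (1 : ℝ) ≤ N := by exact_mod_cast hN
  have hle1 : 1 / (N : ℝ) ^ 3 ≤ 1 := by
    rw [div_le_one (by positivity)]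
    exact one_le_pow₀ hN'
  rcases le_or_gt 1 y with h | h
  · lift y to ℕ using by omega
    have h1 : 1 ≤ y := by exact_mod_cast h
    have h2 : y ≤ N := by exact_mod_cast hy
    have e := pairWeight_of_pos (show 1 ≤ y + 1 by omega)
    push_cast at e
    rw [pairWeight_of_pos h1, e]
    have h3 := inv_cube_le_diffWeight_sub h1
    have h4 := diffWeight_antitone (show y + 1 ≤ y + 2 by omega)
    have h5 : 1 / (N : ℝ) ^ 3 ≤ 1 / (y : ℝ) ^ 3 := by
      have : (1 : ℝ) ≤ y := by exact_mod_cast h1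
      have : (y : ℝ) ≤ N := by exact_mod_cast h2
      gcongr
    have h6 : diffWeight (y + 1 + 1) = diffWeight (y + 2) := rfl
    linarith
  · rcases (show y ≤ 0 by omega).eq_or_lt with rfl | h0
    · have : pairWeight (0 + 1) = diffWeight 1 + diffWeight 2 := by
        simpa using pairWeight_of_pos (le_refl 1)
      rw [this, pairWeight, if_neg (by omega)]
      push_cast
      linarith
    · rw [pairWeight, if_neg (by omega), pairWeight, if_neg (by omega)]
      push_cast
      linarith

theorem pairWeight_antitone : Antitone pairWeight := by
  refine antitone_int_of_succ_le fun y => ?_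
  have := inv_cube_le_pairWeight_sub (y := y) (N := y.toNat + 1) (by omega) (by omega)
  have h2 : 0 ≤ 1 / ((y.toNat + 1 : ℕ) : ℝ) ^ 3 := by positivity
  linarith

theorem pairWeight_nonneg (y : ℤ) : 0 ≤ pairWeight y := by
  unfold pairWeight
  have h1 := diffWeight_nonneg 1
  have h2 := diffWeight_nonneg 2
  split_ifs with h
  · exact add_nonneg (diffWeight_nonneg _) (diffWeight_nonneg _)
  · have : (y : ℝ) ≤ 1 := by exact_mod_cast (by omega : y ≤ 1)
    linarith

theorem mul_inv_cube_le_pairWeight_sub {y : ℤ} {k N : ℕ} (hN : 1 ≤ N) (hy : y + k ≤ N) :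
    k * (1 / (N : ℝ) ^ 3) ≤ pairWeight y - pairWeight (y + k) := by
  induction k with
  | zero => simp
  | succ k ih =>
    push_cast at hy ⊢
    have h1 := ih (by omega)
    have h2 := inv_cube_le_pairWeight_sub (y := y + k) hN (by omega)
    rw [add_assoc] at h2
    linarith

theorem sum_diffWeight_sub {c M : ℕ} (h : c ≤ M) :
    ∑ i ∈ Finset.range c, diffWeight (M - i) = diffWeightSum M - diffWeightSum (M - c) := by
  induction c with
  | zero => simp
  | succ c ih =>
    have e := diffWeightSum_succ (M - (c + 1))
    rw [show M - (c + 1) + 1 = M - c by omega] at e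
    rw [Finset.sum_range_succ, ih (by omega), e]
    ring

theorem sum_diffWeight_pairs {c M : ℕ} (h : 2 * c ≤ M) :
    ∑ i ∈ Finset.range c, (diffWeight (M - 2 * i - 1) + diffWeight (M - 2 * i))
      = diffWeightSum M - diffWeightSum (M - 2 * c) := by
  induction c with
  | zero => simp
  | succ c ih =>
    have e := diffWeightSum_succ (M - 2 * (c + 1))
    have e' := diffWeightSum_succ (M - 2 * c - 1)
    rw [show M - 2 * (c + 1) + 1 = M - 2 * c - 1 by omega] at e
    rw [show M - 2 * c - 1 + 1 = M - 2 * c by omega] at e'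
    rw [Finset.sum_range_succ, ih (by omega), e', e]
    ring

end Weights

/-! ### The Lyapunov function and the summability of inversions. -/

section Lyapunov

/-- The weight of a pair `m < n`. -/
noncomputable def cellWeight (m n : ℕ) : ℝ := diffWeight (n - m) - pairWeight (2 * m - n)

/-- The Lyapunov function: the weight of the pairs still open at time `N`, when packed as low as
possible. -/
noncomputable def lyapunov (f : ℕ → ℕ → ℕ) (N : ℕ) : ℝ :=
  ∑ m ∈ Finset.range N, ∑ i ∈ Finset.range (openCount f m N), cellWeight m (N + i)

/-- Along diagonals only the second part of the weight changes. -/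
theorem cellWeight_add_le {m k N : ℕ} (hm : m < N) (hk : k ≤ m) :
    cellWeight (m - k) N + k * (1 / (N : ℝ) ^ 3) ≤ cellWeight m (N + k) := by
  have h := mul_inv_cube_le_pairWeight_sub (y := 2 * ((m - k : ℕ) : ℤ) - N) (k := k) (N := N)
    (by omega) (by omega)
  rw [cellWeight, cellWeight, show N - (m - k) = N + k - m by omega]
  rw [show 2 * ((m - k : ℕ) : ℤ) - N + k = 2 * m - (N + k : ℕ) by omega] at h
  linarith

theorem cellWeight_antitone {m n n' : ℕ} (h : n ≤ n') : cellWeight m n' ≤ cellWeight m n := by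
  have h1 := diffWeight_antitone (show n - m ≤ n' - m by omega)
  have h2 := pairWeight_antitone (show 2 * (m : ℤ) - n' ≤ 2 * m - n by omega)
  unfold cellWeight
  linarith

/-- The weight of the lowest `N - 1 - 2 * R` pairs in column `N`. -/
theorem sum_cellWeight_column {N R : ℕ} (h : 2 * R + 1 ≤ N) :
    ∑ i ∈ Finset.range (N - 1 - 2 * R), cellWeight N (N + 1 + i)
      = diffWeightSum (N - 1 - 2 * R) - (diffWeightSum (N - 1) - diffWeightSum (2 * R))
        - (diffWeightSum N - diffWeightSum (2 * R + 1)) := by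
  have e1 := sum_diffWeight_sub (show N - 1 - 2 * R ≤ N - 1 by omega)
  have e2 := sum_diffWeight_sub (show N - 1 - 2 * R ≤ N by omega)
  rw [show N - 1 - (N - 1 - 2 * R) = 2 * R by omega] at e1
  rw [show N - (N - 1 - 2 * R) = 2 * R + 1 by omega] at e2
  rw [← e1, ← e2, diffWeightSum, ← Finset.sum_sub_distrib, ← Finset.sum_sub_distrib]
  refine Finset.sum_congr rfl fun i hi => ?_
  rw [Finset.mem_range] at hi
  rw [cellWeight, show N + 1 + i - N = i + 1 by omega,
    show 2 * (N : ℤ) - (N + 1 + i : ℕ) = (N - 1 - i : ℕ) by omega, pairWeight_of_pos (by omega),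
    show N - 1 - i + 1 = N - i by omega]
  ring

/-- The weight of the `R` pairs of row `N` next to the diagonal. -/
theorem sum_cellWeight_row {N R : ℕ} (h : 2 * R + 1 ≤ N) :
    ∑ i ∈ Finset.range R, cellWeight (N - 1 - i) N
      = diffWeightSum R - (diffWeightSum (N - 1) - diffWeightSum (N - 1 - 2 * R)) := by
  rw [← sum_diffWeight_pairs (by omega), diffWeightSum, ← Finset.sum_sub_distrib]
  refine Finset.sum_congr rfl fun i hi => ?_
  rw [Finset.mem_range] at hi
  rw [cellWeight, show N - (N - 1 - i) = i + 1 by omega,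
    show 2 * ((N - 1 - i : ℕ) : ℤ) - N = (N - 1 - 2 * i - 1 : ℕ) by omega,
    pairWeight_of_pos (by omega), show N - 1 - 2 * i - 1 + 1 = N - 1 - 2 * i by omega]

theorem column_sub_row {N R : ℕ} (h : 2 * R + 1 ≤ N) :
    ∑ i ∈ Finset.range (N - 1 - 2 * R), cellWeight N (N + 1 + i)
      - ∑ i ∈ Finset.range R, cellWeight (N - 1 - i) N
      = Real.log ((N + 1) / N) - if R = 0 then Real.log 2 else 0 := by
  have e := diffWeightSum_double R
  rw [sum_cellWeight_column h, sum_cellWeight_row h]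
  have e2 := diffWeightSum_eq (show 1 ≤ N by omega)
  split_ifs at e ⊢ <;> linarith

namespace IsNimTable

variable {f : ℕ → ℕ → ℕ} {L : ℕ}

/-- The lowest packed cell `(m, N)` always leaves. If it is not an actual cell, the column keeps its
count and gains a packed cell on top. -/
theorem sum_openCount_succ (hf : IsNimTable f L) (m N : ℕ) :
    ∑ i ∈ Finset.range (openCount f m (N + 1)), cellWeight m (N + 1 + i)
      = ∑ i ∈ Finset.range (openCount f m N), cellWeight m (N + i) - cellWeight m N
        + if f m N < m then 0 else cellWeight m (N + openCount f m N) := by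
  have h := hf.openCount_succ m N
  split_ifs at h ⊢ with hb
  · rw [h, Finset.sum_range_succ']
    simp only [add_zero, add_assoc, add_comm 1]
    ring
  · rw [add_zero] at h
    rw [← h]
    have e1 := Finset.sum_range_succ (fun i => cellWeight m (N + i)) (openCount f m N)
    have e2 := Finset.sum_range_succ' (fun i => cellWeight m (N + i)) (openCount f m N)
    rw [e1, add_zero] at e2
    rw [show ∑ i ∈ Finset.range (openCount f m N), cellWeight m (N + 1 + i)
      = ∑ i ∈ Finset.range (openCount f m N), cellWeight m (N + (i + 1)) from
      Finset.sum_congr rfl fun i _ => by rw [add_assoc, add_comm 1]]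
    linarith

/-- Row `N` is removed from all columns, and column `N` is added. Were the cells of row `N` packed
next to the diagonal, the net change would be the exact value in `column_sub_row`; every inversion
adds at least `1 / N ^ 3`. -/
theorem lyapunov_succ (hf : IsNimTable f L) {N : ℕ} (hN : 3 * L ≤ N) :
    lyapunov f N + Real.log ((N + 1) / N) - (if midCount f N N = 0 then Real.log 2 else 0)
      + rowInversions f N * (1 / (N : ℝ) ^ 3) ≤ lyapunov f (N + 1) := by
  have hcount := hf.openCount_add_two_mul_midCount hN
  have hopen : openCount f N (N + 1) = N - 1 - 2 * midCount f N N := by omega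
  have hR : 2 * midCount f N N + 1 ≤ N := by omega
  have hKG := column_sub_row hR
  have hstep : lyapunov f (N + 1) = lyapunov f N - ∑ m ∈ Finset.range N, cellWeight m N
      + ∑ m ∈ (Finset.range N).filter (fun m => ¬ f m N < m), cellWeight m (N + openCount f m N)
      + ∑ i ∈ Finset.range (N - 1 - 2 * midCount f N N), cellWeight N (N + 1 + i) := by
    rw [lyapunov, Finset.sum_range_succ, hopen]
    congr 1
    rw [Finset.sum_congr rfl fun m _ => hf.sum_openCount_succ m N, Finset.sum_add_distrib,
      Finset.sum_sub_distrib, Finset.sum_filter, lyapunov]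
    congr 1
    exact Finset.sum_congr rfl fun m _ => by split_ifs <;> rfl
  -- The packed cell gained by column `m` lies no higher than `N + midCount f m N`. Sliding it down
  -- its diagonal to row `N` leads to column `m - midCount f m N`, the rank of `m` among the columns
  -- missing row `N`.
  have hwhite : ∑ j ∈ Finset.range (N - midCount f N N), cellWeight j N
      + rowInversions f N * (1 / (N : ℝ) ^ 3)
      ≤ ∑ m ∈ (Finset.range N).filter (fun m => ¬ f m N < m),
          cellWeight m (N + openCount f m N) := by
    have e := sum_filter_not_rank (fun m => f m N < m) (fun j => cellWeight j N) N
    rw [midCount, ← e, rowInversions, Nat.cast_sum, Finset.sum_mul, ← Finset.sum_add_distrib]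
    refine Finset.sum_le_sum fun m hm => ?_
    rw [Finset.mem_filter, Finset.mem_range] at hm
    refine (cellWeight_add_le hm.1 (midCount_le f m N)).trans (cellWeight_antitone ?_)
    have := hf.openCount_le_midCount hN hm.1 hm.2
    omega
  have hsplit : ∑ m ∈ Finset.range N, cellWeight m N
      = ∑ j ∈ Finset.range (N - midCount f N N), cellWeight j N
        + ∑ i ∈ Finset.range (midCount f N N), cellWeight (N - 1 - i) N := by
    have hle := midCount_le f N N
    rw [← Finset.sum_range_add_sum_Ico _ (Nat.sub_le N (midCount f N N))]
    congr 1
    rw [Finset.sum_Ico_eq_sum_range, show N - (N - midCount f N N) = midCount f N N by omega,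
      ← Finset.sum_range_reflect]
    refine Finset.sum_congr rfl fun i hi => ?_
    rw [Finset.mem_range] at hi
    congr 1
    omega
  linarith

theorem lyapunov_eq_zero (hf : IsNimTable f L) {N : ℕ} (hN : 3 * L ≤ N)
    (h : midCount f N N = 0) : lyapunov f N = 0 := by
  refine Finset.sum_eq_zero fun m hm => ?_
  rw [hf.openCount_eq_zero_of_midCount hN (Finset.mem_range.1 hm) h, Finset.sum_range_zero]

end IsNimTable

/-- Dropping the nonnegative `pairWeight` leaves a tail of the convergent series of `diffWeight`. -/
theorem sum_cellWeight_le (m N k : ℕ) (hm : m < N) :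
    ∑ i ∈ Finset.range k, cellWeight m (N + i)
      ≤ 2 + Real.log 2 - diffWeightSum (N - m - 1) := by
  have h1 : ∑ i ∈ Finset.range k, cellWeight m (N + i)
      ≤ ∑ i ∈ Finset.range k, diffWeight (N - m - 1 + i + 1) := by
    refine Finset.sum_le_sum fun i _ => ?_
    rw [cellWeight, show N + i - m = N - m - 1 + i + 1 by omega]
    linarith [pairWeight_nonneg (2 * m - (N + i : ℕ))]
  have h2 : diffWeightSum (N - m - 1 + k) = diffWeightSum (N - m - 1)
      + ∑ i ∈ Finset.range k, diffWeight (N - m - 1 + i + 1) := Finset.sum_range_add _ _ _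
  linarith [diffWeightSum_le (N - m - 1 + k)]

theorem sum_diffWeightSum_tail {N : ℕ} (hN : 1 ≤ N) :
    ∑ j ∈ Finset.range N, (2 + Real.log 2 - diffWeightSum j) = 2 + Real.log 2 + Real.log N := by
  induction N, hN using Nat.le_induction with
  | base => simp [diffWeightSum]
  | succ N hN ih =>
    have h1 : (1 : ℝ) ≤ N := by exact_mod_cast hN
    rw [Finset.sum_range_succ, ih, diffWeightSum_eq hN, Real.log_div (by positivity) (by positivity)]
    push_cast
    ring

theorem lyapunov_le (f : ℕ → ℕ → ℕ) {N : ℕ} (hN : 1 ≤ N) :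
    lyapunov f N ≤ 2 + Real.log 2 + Real.log N := by
  rw [← sum_diffWeightSum_tail hN, ← Finset.sum_range_reflect, lyapunov]
  refine Finset.sum_le_sum fun m hm => ?_
  rw [Finset.mem_range] at hm
  rw [show N - 1 - m = N - m - 1 by omega]
  exact sum_cellWeight_le m N _ hm

namespace IsNimTable

variable {f : ℕ → ℕ → ℕ} {L : ℕ}

/-- Number of `n` with `N₀ ≤ n < N` which are greatest in no `P`-triple with distinct heaps. -/
def closedCount (f : ℕ → ℕ → ℕ) (N₀ N : ℕ) : ℕ :=
  ((Finset.Ico N₀ N).filter fun n => midCount f n n = 0).card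

theorem closedCount_succ {f : ℕ → ℕ → ℕ} {N₀ N : ℕ} (h : N₀ ≤ N) :
    closedCount f N₀ (N + 1) = closedCount f N₀ N + if midCount f N N = 0 then 1 else 0 := by
  rw [closedCount, closedCount, Finset.card_filter, Finset.card_filter, Finset.sum_Ico_succ_top h]

theorem sum_rowInversions_le (hf : IsNimTable f L) {N : ℕ} (hN : 3 * L ≤ N) :
    ∑ n ∈ Finset.Ico (3 * L) N, rowInversions f n * (1 / (n : ℝ) ^ 3)
      ≤ lyapunov f N - lyapunov f (3 * L) - Real.log N + Real.log (3 * L : ℕ)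
        + closedCount f (3 * L) N * Real.log 2 := by
  have hL := hf.pos
  induction N, hN using Nat.le_induction with
  | base => simp [closedCount]
  | succ N hN ih =>
    have h := hf.lyapunov_succ hN
    have h1 : (0 : ℝ) < N := by exact_mod_cast (by omega : 0 < N)
    rw [Real.log_div (by positivity) (by positivity)] at h
    rw [Finset.sum_Ico_succ_top hN, closedCount_succ hN]
    push_cast at ih ⊢
    split_ifs at h ⊢ <;> linarith

/-- Successive empty rows at least double, starting from `3 * L` or later. -/
theorem two_pow_closedCount (hf : IsNimTable f L) {N : ℕ} (hN : 3 * L ≤ N) :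
    closedCount f (3 * L) N = 0 ∨ ∃ n, 3 * L ≤ n ∧ n < N ∧ midCount f n n = 0 ∧
      2 ^ closedCount f (3 * L) N * (3 * L) ≤ 2 * n := by
  induction N, hN using Nat.le_induction with
  | base => simp [closedCount]
  | succ N hN ih =>
    rw [closedCount_succ hN]
    split_ifs with h0
    · refine Or.inr ⟨N, hN, Nat.lt_succ_self N, h0, ?_⟩
      rcases ih with h | ⟨n, h1, h2, h3, h4⟩
      · rw [h]
        omega
      · have := hf.two_mul_le_of_midCount_eq_zero h1 h2 h3 h0
        rw [pow_succ]
        linarith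
    · rcases ih with h | ⟨n, h1, h2, h3, h4⟩
      · exact Or.inl h
      · exact Or.inr ⟨n, h1, by omega, h3, h4⟩

theorem closedCount_mul_log_le (hf : IsNimTable f L) {N : ℕ} (hN : 3 * L ≤ N)
    (h0 : midCount f N N = 0) :
    closedCount f (3 * L) N * Real.log 2 + Real.log (3 * L : ℕ) ≤ Real.log N := by
  have hL := hf.pos
  have key : 2 ^ closedCount f (3 * L) N * (3 * L) ≤ N := by
    rcases hf.two_pow_closedCount hN with h | ⟨n, h1, h2, h3, h4⟩
    · rw [h]
      omega
    · exact h4.trans (hf.two_mul_le_of_midCount_eq_zero h1 h2 h3 h0)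
  have h3L : (0 : ℝ) < (3 * L : ℕ) := by exact_mod_cast (by omega : 0 < 3 * L)
  rw [← Real.log_pow, ← Real.log_mul (by positivity) h3L.ne']
  apply Real.log_le_log (by positivity)
  exact_mod_cast key

/-- The inversions of all rows, weighted by the inverse cubes of the heap sizes, have a finite
sum. -/
theorem summable_rowInversions (hf : IsNimTable f L) :
    Summable fun n : ℕ => rowInversions f n * (1 / (n : ℝ) ^ 3) := by
  have hL := hf.pos
  have hnn : ∀ n : ℕ, 0 ≤ rowInversions f n * (1 / (n : ℝ) ^ 3) := fun n => by positivity
  have hb : ∃ B : ℝ, ∀ M, ∃ N, M ≤ N ∧ 3 * L ≤ N ∧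
      ∑ n ∈ Finset.Ico (3 * L) N, rowInversions f n * (1 / (n : ℝ) ^ 3) ≤ B := by
    -- With finitely many empty rows, `closedCount` is bounded and the growth of `log N` cancels the
    -- upper bound on `lyapunov`. With infinitely many, `N` is taken to be an empty row: there
    -- `lyapunov` vanishes, and the doubling of empty rows makes `log N` absorb the `log 2` terms.
    by_cases hcl : ∃ K, ∀ n, K ≤ n → midCount f n n ≠ 0
    · obtain ⟨K, hK⟩ := hcl
      refine ⟨2 + Real.log 2 - lyapunov f (3 * L) + Real.log (3 * L : ℕ) + K * Real.log 2,
        fun M => ⟨max M (3 * L), le_max_left _ _, le_max_right _ _, ?_⟩⟩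
      refine (hf.sum_rowInversions_le (le_max_right _ _)).trans ?_
      have h1 := lyapunov_le f (show 1 ≤ max M (3 * L) by omega)
      have h2 : closedCount f (3 * L) (max M (3 * L)) ≤ K := by
        rw [closedCount]
        refine (Finset.card_le_card (t := Finset.range K) fun n hn => ?_).trans
          (Finset.card_range K).le
        rw [Finset.mem_filter] at hn
        rw [Finset.mem_range]
        by_contra hge
        exact hK n (by omega) hn.2
      have h3 : (closedCount f (3 * L) (max M (3 * L)) : ℝ) * Real.log 2 ≤ K * Real.log 2 :=
        mul_le_mul_of_nonneg_right (by exact_mod_cast h2) (Real.log_nonneg one_le_two)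
      linarith
    · push Not at hcl
      refine ⟨- lyapunov f (3 * L), fun M => ?_⟩
      obtain ⟨N, hMN, hN⟩ := hcl (max M (3 * L))
      refine ⟨N, by omega, by omega, ?_⟩
      have h1 := hf.sum_rowInversions_le (show 3 * L ≤ N by omega)
      have h2 := hf.closedCount_mul_log_le (by omega) hN
      rw [hf.lyapunov_eq_zero (by omega) hN] at h1
      linarith
  obtain ⟨B, hB⟩ := hb
  rw [← summable_nat_add_iff (3 * L)]
  refine summable_of_sum_range_le (c := B) (fun n => hnn _) fun k => ?_
  obtain ⟨N, hkN, -, hN⟩ := hB (k + 3 * L)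
  refine le_trans ?_ hN
  refine le_trans (le_of_eq ?_) (Finset.sum_le_sum_of_subset_of_nonneg
    (Finset.Ico_subset_Ico_right hkN) fun n _ _ => hnn n)
  rw [Finset.sum_Ico_eq_sum_range, Nat.add_sub_cancel]
  exact Finset.sum_congr rfl fun i _ => by rw [add_comm i]

end IsNimTable

end Lyapunov

/-! ### Comparing the cell counts at `x` and `2 * x`. -/

section Doubling

theorem card_filter_add_not (p : ℕ → Prop) [DecidablePred p] (n : ℕ) :
    ((Finset.range n).filter p).card + ((Finset.range n).filter fun i => ¬ p i).card = n := by
  rw [Finset.card_filter_add_card_filter_not, Finset.card_range]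

theorem card_filter_range_succ (p : ℕ → Prop) [DecidablePred p] (n : ℕ) :
    ((Finset.range (n + 1)).filter p).card
      = ((Finset.range n).filter p).card + if p n then 1 else 0 := by
  rw [Finset.card_filter, Finset.card_filter, Finset.sum_range_succ]

/-- The initial segments of a sequence have more elements satisfying `p` than if all of these were
moved to the end; the total excess is the number of inversions. -/
theorem sum_card_filter_range (p : ℕ → Prop) [DecidablePred p] (n : ℕ) :
    ∑ x ∈ Finset.range (n + 1), ((Finset.range x).filter p).card
      = ∑ x ∈ Finset.range (n + 1), (x - ((Finset.range n).filter fun i => ¬ p i).card)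
        + ∑ m ∈ (Finset.range n).filter (fun m => ¬ p m), ((Finset.range m).filter p).card := by
  induction n with
  | zero => simp
  | succ n ih =>
    have hc := card_filter_add_not p n
    rw [Finset.sum_range_succ, ih, card_filter_range_succ, card_filter_range_succ (fun i => ¬ p i),
      Finset.range_add_one (n := n), Finset.filter_insert, ← Finset.range_add_one]
    by_cases h : p n
    · rw [if_pos h, if_neg (not_not.2 h), if_neg (not_not.2 h), Finset.sum_range_succ _ (n + 1),
        add_zero]
      omega
    · rw [if_neg h, if_pos h, if_pos h, Finset.sum_insert (by simp),
        Finset.sum_range_succ' _ (n + 1)]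
      simp only [Nat.add_sub_add_right, Nat.zero_sub, add_zero]
      omega

theorem sub_card_filter_not_le (p : ℕ → Prop) [DecidablePred p] {x n : ℕ} (h : x ≤ n) :
    x - ((Finset.range n).filter fun i => ¬ p i).card ≤ ((Finset.range x).filter p).card := by
  have h1 := card_filter_add_not p x
  have h2 : ((Finset.range x).filter fun i => ¬ p i).card
      ≤ ((Finset.range n).filter fun i => ¬ p i).card :=
    Finset.card_le_card (Finset.filter_subset_filter _ (Finset.range_mono h))
  omega

/-- Number of `P`-triples of distinct heaps with all heaps smaller than `N`. -/
def tripleCount (f : ℕ → ℕ → ℕ) (N : ℕ) : ℕ := ∑ n ∈ Finset.range N, midCount f n n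

/-- Excess of middle heaps of row `n` below `x`, compared to the arrangement next to the
diagonal. -/
def rowExcess (f : ℕ → ℕ → ℕ) (n x : ℕ) : ℕ := midCount f x n - (x - (n - midCount f n n))

/-- Number of `P`-triples with middle heap `m` and greatest heap smaller than `y`. -/
def columnCount (f : ℕ → ℕ → ℕ) (m y : ℕ) : ℕ :=
  ((Finset.Ico (m + 1) y).filter fun k => f m k < m).card

/-- Deficiency of greatest heaps of column `m` below `y`, compared to the arrangement next to the
diagonal. -/
def columnDefect (f : ℕ → ℕ → ℕ) (m y : ℕ) : ℕ :=
  min (openCount f m (m + 1)) (y - (m + 1)) - columnCount f m y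

/-- Total excess below `x` of all rows that meet the middle heaps below `x`. -/
def totalRowExcess (f : ℕ → ℕ → ℕ) (L x : ℕ) : ℕ :=
  ∑ n ∈ Finset.Ico x (2 * x + L), rowExcess f n x

/-- Total deficiency below `y` of all columns. -/
def totalColumnDefect (f : ℕ → ℕ → ℕ) (y : ℕ) : ℕ :=
  ∑ m ∈ Finset.range y, columnDefect f m y

theorem card_not_mid (f : ℕ → ℕ → ℕ) (n : ℕ) :
    ((Finset.range n).filter fun m => ¬ f m n < m).card = n - midCount f n n := by
  have := card_filter_add_not (fun m => f m n < m) n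
  unfold midCount
  omega

theorem sum_rowExcess (f : ℕ → ℕ → ℕ) (n : ℕ) :
    ∑ x ∈ Finset.range (n + 1), rowExcess f n x = rowInversions f n := by
  have h := sum_card_filter_range (fun m => f m n < m) n
  rw [card_not_mid] at h
  have h2 : ∑ x ∈ Finset.range (n + 1), midCount f x n
      = ∑ x ∈ Finset.range (n + 1), (rowExcess f n x + (x - (n - midCount f n n))) := by
    refine Finset.sum_congr rfl fun x hx => ?_
    rw [Finset.mem_range] at hx
    have := sub_card_filter_not_le (fun m => f m n < m) (show x ≤ n by omega)
    rw [card_not_mid] at this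
    rw [rowExcess, Nat.sub_add_cancel]
    exact this
  rw [Finset.sum_add_distrib] at h2
  simp only [midCount] at h h2
  simp only [rowInversions, midCount]
  simp only [rowExcess, midCount] at *
  omega

namespace IsNimTable

variable {f : ℕ → ℕ → ℕ} {L : ℕ}

theorem columnCount_le (hf : IsNimTable f L) {m y : ℕ} (h : m < y) :
    columnCount f m y ≤ min (openCount f m (m + 1)) (y - (m + 1)) := by
  refine le_min ?_ ?_
  · rw [hf.openCount_eq_card (show m + 1 ≤ y from h)]
    exact Nat.le_add_right _ _
  · simpa [columnCount] using
      Finset.card_filter_le (Finset.Ico (m + 1) y) fun k => f m k < m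

theorem columnDefect_eq_zero (hf : IsNimTable f L) {m y : ℕ} (h : m < y) (hy : 2 * m + L ≤ y) :
    columnDefect f m y = 0 := by
  have h1 := hf.openCount_eq_card (m := m) (show m + 1 ≤ y from h)
  rw [hf.openCount_eq_zero hy, add_zero] at h1
  rw [columnDefect, columnCount, ← h1]
  omega

/-- Column `m` is exhausted by row `2 * m + L`, so `m + L` rows show all of its cells, and the total
deficiency is its number of inversions. -/
theorem sum_columnDefect (hf : IsNimTable f L) (m : ℕ) :
    ∑ x ∈ Finset.range (m + L + 1), columnDefect f m (m + 1 + x)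
      = ∑ j ∈ (Finset.range (m + L)).filter (fun j => ¬ f m (m + 1 + j) < m),
          openCount f m (m + 1 + j) := by
  have hcol : ∀ x, columnCount f m (m + 1 + x)
      = ((Finset.range x).filter fun j => f m (m + 1 + j) < m).card := by
    intro x
    rw [columnCount, Finset.card_filter, Finset.sum_Ico_eq_sum_range, Finset.card_filter,
      Nat.add_sub_cancel_left]
  have hopen : ∀ j, j ≤ m + L → openCount f m (m + 1 + j)
      = ((Finset.Ico j (m + L)).filter fun i => f m (m + 1 + i) < m).card := by
    intro j hj
    rw [hf.openCount_eq_card (show m + 1 + j ≤ m + 1 + (m + L) by omega),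
      hf.openCount_eq_zero (show 2 * m + L ≤ m + 1 + (m + L) by omega), add_zero,
      Finset.card_filter, Finset.card_filter, add_comm (m + 1) j, add_comm (m + 1) (m + L)]
    exact (Finset.sum_Ico_add (fun i => if f m i < m then 1 else 0) j (m + L) (m + 1)).symm
  have hC : ((Finset.range (m + L)).filter fun j => f m (m + 1 + j) < m).card
      = openCount f m (m + 1) := by
    rw [Finset.range_eq_Ico]
    exact (hopen 0 (Nat.zero_le _)).symm
  have h := sum_card_filter_range (fun j => ¬ f m (m + 1 + j) < m) (m + L)
  simp only [not_not] at h
  rw [hC] at h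
  have h2 : ∑ x ∈ Finset.range (m + L + 1),
      ((Finset.range x).filter fun j => ¬ f m (m + 1 + j) < m).card
      = ∑ x ∈ Finset.range (m + L + 1),
        (columnDefect f m (m + 1 + x) + (x - openCount f m (m + 1))) := by
    refine Finset.sum_congr rfl fun x _ => ?_
    have h3 := hf.columnCount_le (show m < m + 1 + x by omega)
    have h4 := card_filter_add_not (fun j => f m (m + 1 + j) < m) x
    rw [columnDefect]
    rw [hcol] at h3 ⊢
    omega
  rw [Finset.sum_add_distrib] at h2
  -- The same inversions, counted from the missing cell instead of from the cell above it.
  have h5 : ∑ j ∈ (Finset.range (m + L)).filter (fun j => f m (m + 1 + j) < m),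
        ((Finset.range j).filter fun i => ¬ f m (m + 1 + i) < m).card
      = ∑ j ∈ (Finset.range (m + L)).filter (fun j => ¬ f m (m + 1 + j) < m),
          openCount f m (m + 1 + j) := by
    simp only [Finset.card_eq_sum_ones]
    rw [Finset.sum_comm' (t' := (Finset.range (m + L)).filter fun j => ¬ f m (m + 1 + j) < m)
      (s' := fun i => (Finset.Ico i (m + L)).filter fun j => f m (m + 1 + j) < m)]
    · refine Finset.sum_congr rfl fun i hi => ?_
      rw [Finset.mem_filter, Finset.mem_range] at hi
      rw [hopen i (by omega), Finset.card_eq_sum_ones]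
    · intro j i
      simp only [Finset.mem_filter, Finset.mem_range, Finset.mem_Ico]
      constructor
      · rintro ⟨⟨h1, h2⟩, h3, h4⟩
        exact ⟨⟨⟨by omega, h1⟩, h2⟩, by omega, h4⟩
      · rintro ⟨⟨⟨h1, h2⟩, h3⟩, h4, h5⟩
        have : i ≠ j := by rintro rfl; exact h5 h3
        exact ⟨⟨h2, h3⟩, by omega, h5⟩
  omega

/-- The middle heaps below `x`, counted by rows. -/
theorem sum_openCount (hf : IsNimTable f L) (x : ℕ) :
    ∑ m ∈ Finset.range x, openCount f m (m + 1)
      = tripleCount f x + ∑ n ∈ Finset.Ico x (2 * x + L), (x - (n - midCount f n n))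
        + totalRowExcess f L x := by
  have hL := hf.pos
  have h1 : ∑ m ∈ Finset.range x, openCount f m (m + 1)
      = ∑ n ∈ Finset.range (2 * x + L), midCount f (min x n) n := by
    have e : ∀ m ∈ Finset.range x, openCount f m (m + 1)
        = ∑ n ∈ Finset.Ico (m + 1) (2 * x + L), if f m n < m then 1 else 0 := by
      intro m hm
      rw [Finset.mem_range] at hm
      rw [hf.openCount_eq_card (show m + 1 ≤ 2 * x + L by omega),
        hf.openCount_eq_zero (by omega), add_zero, Finset.card_filter]
    rw [Finset.sum_congr rfl e]
    simp only [midCount, Finset.card_filter]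
    refine Finset.sum_comm' fun m n => ?_
    simp only [Finset.mem_range, Finset.mem_Ico]
    omega
  rw [h1, Finset.range_eq_Ico, ← Finset.sum_Ico_consecutive _ (Nat.zero_le x) (by omega), add_assoc,
    tripleCount, Finset.range_eq_Ico, totalRowExcess, ← Finset.sum_add_distrib]
  congr 1
  · refine Finset.sum_congr rfl fun n hn => ?_
    rw [Finset.mem_Ico] at hn
    rw [min_eq_right (by omega)]
  · refine Finset.sum_congr rfl fun n hn => ?_
    rw [Finset.mem_Ico] at hn
    rw [min_eq_left (by omega), rowExcess]
    have := sub_card_filter_not_le (fun m => f m n < m) hn.1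
    rw [card_not_mid] at this
    unfold midCount at *
    omega

/-- The greatest heaps below `y`, counted by columns. -/
theorem tripleCount_add_totalColumnDefect (hf : IsNimTable f L) (y : ℕ) :
    tripleCount f y + totalColumnDefect f y
      = ∑ m ∈ Finset.range y, min (openCount f m (m + 1)) (y - (m + 1)) := by
  have h1 : tripleCount f y = ∑ m ∈ Finset.range y, columnCount f m y := by
    simp only [tripleCount, midCount, columnCount, Finset.card_filter]
    refine Finset.sum_comm' fun n m => ?_
    simp only [Finset.mem_range, Finset.mem_Ico]
    omega
  rw [h1, totalColumnDefect, ← Finset.sum_add_distrib]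
  refine Finset.sum_congr rfl fun m hm => ?_
  have := hf.columnCount_le (Finset.mem_range.1 hm)
  rw [columnDefect]
  omega

/-- The summand is `m - 1 - 2 * midCount f m m` from `3 * L` on, so the error stays constant there.
-/
theorem sum_openCount_approx (hf : IsNimTable f L) :
    ∃ K : ℝ, ∀ x : ℕ, |(∑ m ∈ Finset.range x, openCount f m (m + 1) : ℕ)
      - ((x : ℝ) ^ 2 / 2 - 3 * x / 2 - 2 * tripleCount f x)| ≤ K := by
  have hstep : ∀ x, 3 * L ≤ x → ((∑ m ∈ Finset.range (x + 1), openCount f m (m + 1) : ℕ) : ℝ)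
      - (((x + 1 : ℕ) : ℝ) ^ 2 / 2 - 3 * ((x + 1 : ℕ) : ℝ) / 2 - 2 * tripleCount f (x + 1))
      = ((∑ m ∈ Finset.range x, openCount f m (m + 1) : ℕ) : ℝ)
      - ((x : ℝ) ^ 2 / 2 - 3 * x / 2 - 2 * tripleCount f x) := by
    intro x hx
    have h := hf.openCount_add_two_mul_midCount hx
    have h' : (openCount f x (x + 1) : ℝ) + 2 * midCount f x x + 1 = x := by exact_mod_cast h
    rw [Finset.sum_range_succ, tripleCount, Finset.sum_range_succ, ← tripleCount]
    push_cast
    linarith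
  refine ⟨∑ x ∈ Finset.range (3 * L + 1), |(∑ m ∈ Finset.range x, openCount f m (m + 1) : ℕ)
      - ((x : ℝ) ^ 2 / 2 - 3 * x / 2 - 2 * tripleCount f x)|, fun x => ?_⟩
  have hsmall : ∀ x ∈ Finset.range (3 * L + 1), _ := fun x hx =>
    Finset.single_le_sum (f := fun x : ℕ => |((∑ m ∈ Finset.range x, openCount f m (m + 1) : ℕ) : ℝ)
      - ((x : ℝ) ^ 2 / 2 - 3 * x / 2 - 2 * tripleCount f x)|) (fun _ _ => abs_nonneg _) hx
  rcases le_or_gt x (3 * L) with h | h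
  · exact hsmall x (Finset.mem_range.2 (by omega))
  · induction x, h.le using Nat.le_induction with
    | base => omega
    | succ x hx ih =>
      rw [hstep x hx]
      rcases hx.eq_or_lt with rfl | hlt
      · exact hsmall _ (Finset.mem_range.2 (by omega))
      · exact ih hlt

/-- For `m ≥ 3 * L` the column count `m - 1 - 2 * R` falls short of `2 * x - m - 1` by `2 * (x - (m
- R))`, so the minimum is the latter bound minus twice a truncated difference. -/
theorem sum_min_openCount (hf : IsNimTable f L) :
    ∃ K : ℝ, ∀ x : ℕ, |(∑ m ∈ Finset.range (2 * x), min (openCount f m (m + 1)) (2 * x - (m + 1)) : ℕ)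
      - ((x : ℝ) * (2 * x - 1) - 2 * ∑ m ∈ Finset.range (2 * x), ((x - (m - midCount f m m) : ℕ) : ℝ))|
      ≤ K := by
  refine ⟨∑ m ∈ Finset.range (3 * L), (2 * m + 1 : ℝ), fun x => ?_⟩
  have e1 : ((x : ℝ) * (2 * x - 1)) = ∑ m ∈ Finset.range (2 * x), ((2 * x - (m + 1) : ℕ) : ℝ) := by
    have h1 := Finset.sum_range_reflect (fun m => m) (2 * x)
    have h2 := Finset.sum_range_id_mul_two (2 * x)
    rw [← Nat.cast_sum]
    have h3 : ∑ m ∈ Finset.range (2 * x), (2 * x - (m + 1)) = x * (2 * x - 1) := by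
      rw [Finset.sum_congr rfl fun m _ => show 2 * x - (m + 1) = 2 * x - 1 - m by omega, h1]
      rw [mul_comm 2 x, mul_assoc, mul_comm 2, ← mul_assoc] at h2
      have := Nat.eq_of_mul_eq_mul_right two_pos h2
      rw [mul_comm 2 x, this]
    rw [h3]
    rcases Nat.eq_zero_or_pos x with rfl | hx
    · simp
    · rw [Nat.cast_mul, Nat.cast_sub (by omega)]
      push_cast
      ring
  rw [e1, Finset.mul_sum, ← Finset.sum_sub_distrib, Nat.cast_sum, ← Finset.sum_sub_distrib]
  refine (Finset.abs_sum_le_sum_abs _ _).trans ?_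
  have hterm : ∀ m ∈ Finset.range (2 * x),
      |((min (openCount f m (m + 1)) (2 * x - (m + 1)) : ℕ) : ℝ) - (((2 * x - (m + 1) : ℕ) : ℝ)
        - 2 * ((x - (m - midCount f m m) : ℕ) : ℝ))|
      ≤ if m < 3 * L then (2 * m + 1 : ℝ) else 0 := by
    intro m hm
    rw [Finset.mem_range] at hm
    have hR := midCount_le f m m
    have hC := openCount_le f m (m + 1)
    split_ifs with h
    · have h1 : min (openCount f m (m + 1)) (2 * x - (m + 1)) + 2 * (x - (m - midCount f m m))
          ≤ 2 * x - (m + 1) + (2 * m + 1) := by omega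
      have h2 : 2 * x - (m + 1) ≤ min (openCount f m (m + 1)) (2 * x - (m + 1))
          + 2 * (x - (m - midCount f m m)) + (2 * m + 1) := by omega
      have h1' := (Nat.cast_le (α := ℝ)).2 h1
      have h2' := (Nat.cast_le (α := ℝ)).2 h2
      push_cast at h1' h2'
      rw [abs_le]
      push_cast
      constructor <;> linarith
    · have h0 := hf.openCount_add_two_mul_midCount (show 3 * L ≤ m by omega)
      have h1 : min (openCount f m (m + 1)) (2 * x - (m + 1)) + 2 * (x - (m - midCount f m m))
          = 2 * x - (m + 1) := by omega
      have h1' := congrArg (Nat.cast (R := ℝ)) h1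
      push_cast at h1'
      rw [abs_nonpos_iff]
      push_cast
      linarith
  refine (Finset.sum_le_sum hterm).trans ?_
  rw [← Finset.sum_filter]
  refine Finset.sum_le_sum_of_subset_of_nonneg (fun m hm => ?_) fun m _ _ => by positivity
  rw [Finset.mem_filter] at hm
  exact Finset.mem_range.2 hm.2

theorem sum_truncated (hf : IsNimTable f L) {x : ℕ} (hx : 3 * L ≤ x) :
    ∑ m ∈ Finset.range (2 * x), ((x - (m - midCount f m m) : ℕ) : ℝ)
      = x * (x + 1) / 2 + tripleCount f x
        + ∑ n ∈ Finset.Ico x (2 * x + L), ((x - (n - midCount f n n) : ℕ) : ℝ) := by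
  have h1 : ∑ m ∈ Finset.range x, ((x - (m - midCount f m m) : ℕ) : ℝ)
      = x * (x + 1) / 2 + tripleCount f x := by
    have e : ∀ m ∈ Finset.range x, ((x - (m - midCount f m m) : ℕ) : ℝ)
        = x - m + midCount f m m := by
      intro m hm
      rw [Finset.mem_range] at hm
      have := midCount_le f m m
      rw [Nat.cast_sub (by omega), Nat.cast_sub (by omega)]
      ring
    have h2 : ∑ m ∈ Finset.range x, (m : ℝ) = x * (x - 1) / 2 := by
      clear hx e
      induction x with
      | zero => simp
      | succ x ih =>
        rw [Finset.sum_range_succ, ih]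
        push_cast
        ring
    rw [Finset.sum_congr rfl e, Finset.sum_add_distrib, Finset.sum_sub_distrib, h2, tripleCount,
      Nat.cast_sum]
    simp
    ring
  have h3 : ∑ n ∈ Finset.Ico (2 * x) (2 * x + L), ((x - (n - midCount f n n) : ℕ) : ℝ) = 0 := by
    refine Finset.sum_eq_zero fun n hn => ?_
    rw [Finset.mem_Ico] at hn
    have := hf.openCount_add_two_mul_midCount (show 3 * L ≤ n by omega)
    rw [Nat.cast_eq_zero]
    omega
  rw [← Finset.sum_Ico_consecutive _ (show x ≤ 2 * x by omega) (show 2 * x ≤ 2 * x + L by omega), h3,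
    ← Finset.sum_range_add_sum_Ico _ (show x ≤ 2 * x by omega), h1]
  ring

/-- Doubling the bound on the heaps multiplies the number of `P`-triples by four, up to the total
displacements of rows and columns. -/
theorem tripleCount_double (hf : IsNimTable f L) :
    ∃ K : ℝ, ∀ x : ℕ, 3 * L ≤ x → |(tripleCount f (2 * x) : ℝ) - 4 * tripleCount f x|
      ≤ 2 * totalRowExcess f L x + totalColumnDefect f (2 * x) + (x + K) := by
  obtain ⟨K₁, h₁⟩ := hf.sum_openCount_approx
  obtain ⟨K₂, h₂⟩ := hf.sum_min_openCount
  -- Eliminating the truncated sum over `n ≥ x` between the row count and the column count gives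
  -- T(2x) + D = 4 T(x) + 2 E + x up to this constant, with E the row excess and D the column
  -- defect.
  refine ⟨2 * K₁ + K₂, fun x hx => ?_⟩
  have a1 := abs_le.1 (h₁ x)
  have a2 := abs_le.1 (h₂ x)
  have a3 := hf.sum_truncated hx
  have a4 := congrArg (Nat.cast (R := ℝ)) (hf.sum_openCount x)
  have a5 := congrArg (Nat.cast (R := ℝ)) (hf.tripleCount_add_totalColumnDefect (2 * x))
  rw [Nat.cast_add, Nat.cast_add, Nat.cast_sum (Finset.Ico _ _)] at a4
  rw [Nat.cast_add] at a5
  have p1 : (0 : ℝ) ≤ totalRowExcess f L x := Nat.cast_nonneg _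
  have p2 : (0 : ℝ) ≤ totalColumnDefect f (2 * x) := Nat.cast_nonneg _
  have p3 : (0 : ℝ) ≤ x := Nat.cast_nonneg _
  rw [a4] at a1
  rw [← a5, a3] at a2
  rw [abs_le]
  constructor <;> nlinarith [a1.1, a1.2, a2.1, a2.2]

end IsNimTable

end Doubling

/-! ### Convergence along `n * 2 ^ k` from approximate doubling. -/

section DoublingLimit

theorem abs_sub_le_of_abs_succ_sub_le {T : ℕ → ℝ} {C : ℝ} (hC : 0 ≤ C)
    (hT : ∀ x : ℕ, |T (x + 1) - T x| ≤ C * (x + 1)) (x j : ℕ) :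
    |T (x + j) - T x| ≤ C * j * (x + j) := by
  induction j with
  | zero => simp
  | succ j ih =>
    have h1 := hT (x + j)
    have h2 := abs_sub_le (T (x + (j + 1))) (T (x + j)) (T x)
    rw [← add_assoc] at h2 ⊢
    push_cast at h1 ⊢
    have h3 : 0 ≤ C * j := by positivity
    nlinarith

theorem sum_range_two_pow_succ (T : ℕ → ℝ) (a k : ℕ) :
    ∑ i ∈ Finset.range (2 ^ (k + 1)), T (2 ^ (k + 1) * a + i)
      = ∑ i ∈ Finset.range (2 ^ k), (T (2 * (2 ^ k * a + i)) + T (2 * (2 ^ k * a + i) + 1)) := by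
  have h : ∀ (g : ℕ → ℝ) (n : ℕ),
      ∑ i ∈ Finset.range (2 * n), g i = ∑ i ∈ Finset.range n, (g (2 * i) + g (2 * i + 1)) := by
    intro g n
    induction n with
    | zero => simp
    | succ n ih =>
      rw [mul_add, Finset.sum_range_succ, Finset.sum_range_succ, ih, Finset.sum_range_succ]
      ring
  rw [pow_succ' 2 k, h]
  refine Finset.sum_congr rfl fun i _ => ?_
  congr 2 <;> ring

/-- The blocks are disjoint, since `2 ^ k * (a + 1) ≤ 2 ^ (k + 1) * a`. -/
theorem sum_blocks_le {d : ℕ → ℝ} (hd : ∀ x, 0 ≤ d x) {a : ℕ} (ha : 0 < a) (K : ℕ) :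
    ∑ k ∈ Finset.range K, ∑ i ∈ Finset.range (2 ^ k), d (2 ^ k * a + i)
      ≤ ∑ x ∈ Finset.range (2 ^ K * a), d x := by
  induction K with
  | zero => simpa using Finset.sum_nonneg fun x _ => hd x
  | succ K ih =>
    have h1 : 2 ^ K * a + 2 ^ K ≤ 2 ^ (K + 1) * a := by
      rw [pow_succ]
      nlinarith [Nat.two_pow_pos K]
    rw [Finset.sum_range_succ]
    refine le_trans (add_le_add_left ih _) ?_
    rw [← Finset.sum_range_add]
    exact Finset.sum_le_sum_of_subset_of_nonneg (Finset.range_mono h1) fun x _ _ => hd x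

/-- Normalised average of `T` over the integers of `2 ^ k * [a, a + 1)`. -/
noncomputable def blockMean (T : ℕ → ℝ) (a k : ℕ) : ℝ :=
  (∑ i ∈ Finset.range (2 ^ k), T (2 ^ k * a + i)) / 8 ^ k

theorem abs_blockMean_sub_le {T : ℕ → ℝ} {C : ℝ} (hC : 0 ≤ C)
    (hT : ∀ x : ℕ, |T (x + 1) - T x| ≤ C * (x + 1)) (a k : ℕ) :
    |T (2 ^ k * a) / 4 ^ k - blockMean T a k| ≤ C * (a + 1) := by
  have h8 : (8 : ℝ) ^ k = 4 ^ k * 2 ^ k := by rw [← mul_pow]; norm_num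
  have h4 : (4 : ℝ) ^ k = 2 ^ k * 2 ^ k := by rw [← mul_pow]; norm_num
  have h2 : (0 : ℝ) < 2 ^ k := by positivity
  have e : T (2 ^ k * a) / 4 ^ k - blockMean T a k
      = (∑ i ∈ Finset.range (2 ^ k), (T (2 ^ k * a) - T (2 ^ k * a + i))) / 8 ^ k := by
    rw [blockMean, Finset.sum_sub_distrib, sub_div]
    congr 1
    rw [Finset.sum_const, Finset.card_range, nsmul_eq_mul, h8]
    push_cast
    field_simp
  rw [e, abs_div, abs_of_pos (show (0 : ℝ) < 8 ^ k by positivity), div_le_iff₀ (by positivity)]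
  refine (Finset.abs_sum_le_sum_abs _ _).trans ?_
  have h : ∀ i ∈ Finset.range (2 ^ k),
      |T (2 ^ k * a) - T (2 ^ k * a + i)| ≤ C * 2 ^ k * (2 ^ k * a + 2 ^ k) := by
    intro i hi
    rw [Finset.mem_range] at hi
    have hi' : (i : ℝ) ≤ 2 ^ k := by exact_mod_cast hi.le
    rw [abs_sub_comm]
    refine (abs_sub_le_of_abs_succ_sub_le hC hT _ i).trans ?_
    push_cast
    gcongr
  refine (Finset.sum_le_sum h).trans (le_of_eq ?_)
  rw [Finset.sum_const, Finset.card_range, nsmul_eq_mul, h8, h4]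
  push_cast
  ring

/-- Summability against `x ^ (-3)` is too weak at single points. Averaging over `2 ^ k` points gains
the missing factor: the normalisation `8 ^ k` is comparable to `x ^ 3` on the block. -/
theorem dist_blockMean_succ_le {T : ℕ → ℝ} {C : ℝ} (hC : 0 ≤ C)
    (hT : ∀ x : ℕ, |T (x + 1) - T x| ≤ C * (x + 1)) {a : ℕ} (ha : 0 < a) (k : ℕ) :
    dist (blockMean T a k) (blockMean T a (k + 1))
      ≤ (a + 1) ^ 3 * ∑ i ∈ Finset.range (2 ^ k),
          |T (2 * (2 ^ k * a + i)) - 4 * T (2 ^ k * a + i)| / ((2 ^ k * a + i : ℕ) : ℝ) ^ 3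
        + C * (a + 1) * (1 / 2) ^ k := by
  have h8 : (8 : ℝ) ^ k = 2 ^ k * 2 ^ k * 2 ^ k := by rw [← mul_pow, ← mul_pow]; norm_num
  have h2 : (0 : ℝ) < 2 ^ k := by positivity
  have e : blockMean T a k - blockMean T a (k + 1)
      = (∑ i ∈ Finset.range (2 ^ k), (8 * T (2 ^ k * a + i)
        - (T (2 * (2 ^ k * a + i)) + T (2 * (2 ^ k * a + i) + 1)))) / (8 * 8 ^ k) := by
    rw [blockMean, blockMean, sum_range_two_pow_succ, Finset.sum_sub_distrib, ← Finset.mul_sum,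
      sub_div, pow_succ' (8 : ℝ) k]
    field_simp
  rw [Real.dist_eq, e, abs_div, abs_of_pos (show (0 : ℝ) < 8 * 8 ^ k by positivity)]
  rw [div_le_iff₀ (by positivity)]
  refine (Finset.abs_sum_le_sum_abs _ _).trans ?_
  have h : ∀ i ∈ Finset.range (2 ^ k),
      |8 * T (2 ^ k * a + i) - (T (2 * (2 ^ k * a + i)) + T (2 * (2 ^ k * a + i) + 1))|
      ≤ 8 * 8 ^ k * (a + 1) ^ 3 * (|T (2 * (2 ^ k * a + i)) - 4 * T (2 ^ k * a + i)|
          / ((2 ^ k * a + i : ℕ) : ℝ) ^ 3) + 8 * (C * (2 ^ k * (a + 1))) := by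
    intro i hi
    rw [Finset.mem_range] at hi
    have hi' : (i : ℝ) + 1 ≤ 2 ^ k := by exact_mod_cast hi
    have hpos : 0 < 2 ^ k * a := by positivity
    set N : ℕ := 2 ^ k * a + i with hN
    have hN0 : (0 : ℝ) < N := by
      have : 0 < N := by omega
      exact_mod_cast this
    have hN1 : (N : ℝ) + 1 ≤ 2 ^ k * (a + 1) := by
      rw [hN]
      push_cast
      linarith
    have hd : |T (2 * N) - 4 * T N|
        ≤ 8 ^ k * (a + 1) ^ 3 * (|T (2 * N) - 4 * T N| / (N : ℝ) ^ 3) := by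
      rw [mul_div_assoc', le_div_iff₀ (by positivity), mul_comm]
      gcongr
      rw [h8, show (2 : ℝ) ^ k * 2 ^ k * 2 ^ k * (a + 1) ^ 3 = (2 ^ k * (a + 1)) ^ 3 by ring]
      gcongr
      linarith
    have hl := hT (2 * N)
    push_cast at hl
    have hCN : C * (N + 1) ≤ C * (2 ^ k * (a + 1)) := by gcongr
    have hC0 : 0 ≤ C * (N + 1) := by positivity
    have hx : |8 * T N - (T (2 * N) + T (2 * N + 1))|
        ≤ 2 * |T (2 * N) - 4 * T N| + |T (2 * N + 1) - T (2 * N)| := by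
      rw [show 8 * T N - (T (2 * N) + T (2 * N + 1))
        = -(2 * (T (2 * N) - 4 * T N) + (T (2 * N + 1) - T (2 * N))) by ring, abs_neg]
      refine (abs_add_le _ _).trans ?_
      rw [abs_mul, abs_two]
    have := abs_nonneg (T (2 * N) - 4 * T N)
    nlinarith
  refine (Finset.sum_le_sum h).trans (le_of_eq ?_)
  rw [Finset.sum_add_distrib, ← Finset.mul_sum, Finset.sum_const, Finset.card_range, nsmul_eq_mul,
    div_pow, one_pow, h8]
  push_cast
  field_simp

theorem cauchySeq_blockMean {T : ℕ → ℝ} {C : ℝ} (hC : 0 ≤ C)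
    (hT : ∀ x : ℕ, |T (x + 1) - T x| ≤ C * (x + 1))
    (hS : Summable fun x : ℕ => |T (2 * x) - 4 * T x| / (x : ℝ) ^ 3) {a : ℕ} (ha : 0 < a) :
    CauchySeq (blockMean T a) := by
  refine cauchySeq_of_dist_le_of_summable _ (dist_blockMean_succ_le hC hT ha) ?_
  refine Summable.add (Summable.mul_left _ ?_)
    (Summable.mul_left _ (summable_geometric_of_lt_one (by norm_num) (by norm_num)))
  have hd : ∀ x : ℕ, 0 ≤ |T (2 * x) - 4 * T x| / (x : ℝ) ^ 3 := fun x => by positivity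
  exact summable_of_sum_range_le (fun k => Finset.sum_nonneg fun i _ => hd _) fun K =>
    (sum_blocks_le hd ha K).trans (hS.sum_le_tsum _ fun x _ => hd x)

/-- If `T` has increments of linear growth and is multiplied by four when its argument is doubled, up
to an error that is summable against `x ^ (-3)`, then `T (n * 2 ^ k) / 4 ^ k` converges. -/
theorem exists_tendsto_of_summable_doubling {T : ℕ → ℝ} {C : ℝ} (hC : 0 ≤ C)
    (hT : ∀ x : ℕ, |T (x + 1) - T x| ≤ C * (x + 1))
    (hS : Summable fun x : ℕ => |T (2 * x) - 4 * T x| / (x : ℝ) ^ 3) {n : ℕ} (hn : 0 < n) :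
    ∃ l, Tendsto (fun k : ℕ => T (n * 2 ^ k) / 4 ^ k) atTop (𝓝 l) := by
  refine cauchySeq_tendsto_of_complete (Metric.cauchySeq_iff'.2 fun ε hε => ?_)
  -- Block means with `a = n * 2 ^ t` approximate the sequence only up to `C * (a + 1)`, but
  -- rescaling by `4 ^ t` turns this into at most `C * (n + 1) / 2 ^ t`.
  obtain ⟨t, ht⟩ : ∃ t : ℕ, C * (n + 1) * (1 / 2) ^ t < ε / 3 := by
    have h : Tendsto (fun t : ℕ => C * ((n : ℝ) + 1) * (1 / 2) ^ t) atTop (𝓝 (C * (n + 1) * 0)) :=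
      (tendsto_pow_atTop_nhds_zero_of_lt_one (by norm_num) (by norm_num)).const_mul _
    rw [mul_zero] at h
    exact (h.eventually (gt_mem_nhds (by positivity))).exists
  have happrox : ∀ k : ℕ,
      |T (n * 2 ^ (k + t)) / 4 ^ (k + t) - blockMean T (n * 2 ^ t) k / 4 ^ t| < ε / 3 := by
    intro k
    have h := abs_blockMean_sub_le hC hT (n * 2 ^ t) k
    have e : T (n * 2 ^ (k + t)) / 4 ^ (k + t) - blockMean T (n * 2 ^ t) k / 4 ^ t
        = (T (2 ^ k * (n * 2 ^ t)) / 4 ^ k - blockMean T (n * 2 ^ t) k) / 4 ^ t := by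
      rw [sub_div, div_div, ← pow_add, show n * 2 ^ (k + t) = 2 ^ k * (n * 2 ^ t) by ring]
    rw [e, abs_div, abs_of_pos (show (0 : ℝ) < 4 ^ t by positivity)]
    refine lt_of_le_of_lt ?_ ht
    rw [div_le_iff₀ (by positivity)]
    refine h.trans ?_
    have h4 : (4 : ℝ) ^ t = 2 ^ t * 2 ^ t := by rw [← mul_pow]; norm_num
    have h1 : (1 : ℝ) ≤ 2 ^ t := one_le_pow₀ (by norm_num)
    rw [h4, div_pow, one_pow, show C * ((n : ℝ) + 1) * (1 / 2 ^ t) * (2 ^ t * 2 ^ t)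
      = C * ((n + 1) * 2 ^ t) by field_simp]
    push_cast
    gcongr
    linarith
  obtain ⟨K, hK⟩ := Metric.cauchySeq_iff'.1
    (cauchySeq_blockMean hC hT hS (show 0 < n * 2 ^ t by positivity)) (ε / 3) (by positivity)
  refine ⟨K + t, fun m hm => ?_⟩
  obtain ⟨k, rfl⟩ : ∃ k, m = k + t := ⟨m - t, by omega⟩
  have h1 := abs_lt.1 (happrox k)
  have h2 := abs_lt.1 (happrox K)
  have h3 := hK k (by omega)
  rw [Real.dist_eq] at h3 ⊢
  have h4 : |blockMean T (n * 2 ^ t) k / 4 ^ t - blockMean T (n * 2 ^ t) K / 4 ^ t| < ε / 3 := by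
    rw [← sub_div, abs_div, abs_of_pos (show (0 : ℝ) < 4 ^ t by positivity)]
    exact (div_le_self (abs_nonneg _) (one_le_pow₀ (by norm_num))).trans_lt h3
  have h4 := abs_lt.1 h4
  rw [abs_lt]
  constructor <;> linarith [h1.1, h1.2, h2.1, h2.2, h4.1, h4.2]

end DoublingLimit

/-! ### From inversions to the doubling error. -/

section Summability

theorem one_div_cube_le {a b : ℕ} (ha : 0 < a) (hb : 0 < b) (h : b ≤ 3 * a) :
    1 / (a : ℝ) ^ 3 ≤ 27 * (1 / (b : ℝ) ^ 3) := by
  have ha' : (0 : ℝ) < a := by exact_mod_cast ha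
  have hb' : (0 : ℝ) < b := by exact_mod_cast hb
  have h' : (b : ℝ) ≤ 3 * a := by exact_mod_cast h
  rw [mul_one_div, div_le_div_iff₀ (by positivity) (by positivity), one_mul,
    show (27 : ℝ) * a ^ 3 = (3 * a) ^ 3 by ring]
  gcongr

theorem sum_Ico_le_of_summable {g h : ℕ → ℝ} (hg : ∀ n, 0 ≤ g n) (hh : ∀ n, 0 ≤ h n)
    (hs : Summable h) (M : ℕ)
    (H : ∀ X, ∃ Y, ∑ x ∈ Finset.Ico M X, g x ≤ ∑ n ∈ Finset.range Y, h n) : Summable g := by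
  rw [← summable_nat_add_iff M]
  refine summable_of_sum_range_le (c := ∑' n, h n) (fun n => hg _) fun k => ?_
  obtain ⟨Y, hY⟩ := H (k + M)
  refine le_trans (le_of_eq ?_) (hY.trans (hs.sum_le_tsum _ fun n _ => hh n))
  rw [Finset.sum_Ico_eq_sum_range, Nat.add_sub_cancel]
  exact Finset.sum_congr rfl fun i _ => by rw [add_comm i]

namespace IsNimTable

variable {f : ℕ → ℕ → ℕ} {L : ℕ}

theorem summable_totalRowExcess (hf : IsNimTable f L) :
    Summable fun x : ℕ => (totalRowExcess f L x : ℝ) / (x : ℝ) ^ 3 := by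
  have hL := hf.pos
  refine sum_Ico_le_of_summable (fun x => by positivity) (fun n => by positivity)
    (hf.summable_rowInversions.mul_left 27) L fun X => ⟨2 * X + L, ?_⟩
  have h1 : ∀ x ∈ Finset.Ico L X, (totalRowExcess f L x : ℝ) / (x : ℝ) ^ 3
      ≤ ∑ n ∈ Finset.Ico x (2 * x + L), 27 * (rowExcess f n x * (1 / (n : ℝ) ^ 3)) := by
    intro x hx
    rw [Finset.mem_Ico] at hx
    rw [totalRowExcess, Nat.cast_sum, Finset.sum_div]
    refine Finset.sum_le_sum fun n hn => ?_
    rw [Finset.mem_Ico] at hn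
    rw [div_eq_mul_one_div, mul_left_comm]
    gcongr
    exact one_div_cube_le (by omega) (by omega) (by omega)
  refine (Finset.sum_le_sum h1).trans ?_
  rw [Finset.sum_comm' (t' := Finset.range (2 * X + L))
    (s' := fun n => (Finset.Ico L X).filter fun x => x ≤ n ∧ n < 2 * x + L)]
  · refine Finset.sum_le_sum fun n _ => ?_
    rw [← sum_rowExcess, Nat.cast_sum, Finset.sum_mul, Finset.mul_sum]
    refine Finset.sum_le_sum_of_subset_of_nonneg (fun x hx => ?_) fun x _ _ => by positivity
    simp only [Finset.mem_filter, Finset.mem_range] at hx ⊢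
    omega
  · intro x n
    simp only [Finset.mem_filter, Finset.mem_range, Finset.mem_Ico]
    omega

/-- The defects of column `m` add up to open counts at its missing cells, and
`openCount_le_midCount` trades these for contributions to `rowInversions`. -/
theorem sum_columnDefect_le (hf : IsNimTable f L) (m A Y : ℕ) (hA : 7 * L ≤ A) :
    ∑ y ∈ (Finset.Ico A Y).filter (fun y => m < y), (columnDefect f m y : ℝ) / (y : ℝ) ^ 3
      ≤ ∑ n ∈ (Finset.Ico (m + 1) (2 * m + L + 1)).filter (fun n => 3 * L ≤ n ∧ ¬ f m n < m),
          27 * (midCount f m n * (1 / (n : ℝ) ^ 3)) := by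
  have hL := hf.pos
  rcases lt_or_ge m (3 * L) with hm | hm
  -- Columns below `3 * L` are exhausted before `7 * L = 2 * (3 * L) + L`.
  · refine le_trans (le_of_eq (Finset.sum_eq_zero fun y hy => ?_))
      (Finset.sum_nonneg fun n _ => by positivity)
    simp only [Finset.mem_filter, Finset.mem_Ico] at hy
    rw [hf.columnDefect_eq_zero (by omega) (by omega)]
    simp
  have h1 : ∑ y ∈ (Finset.Ico A Y).filter (fun y => m < y), (columnDefect f m y : ℝ) / (y : ℝ) ^ 3
      ≤ ∑ y ∈ Finset.Ico (m + 1) (2 * m + L + 2),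
          (columnDefect f m y : ℝ) * (1 / ((m + 1 : ℕ) : ℝ) ^ 3) := by
    rw [← Finset.sum_filter_of_ne (p := fun y => y < 2 * m + L)]
    · refine le_trans (Finset.sum_le_sum fun y hy => ?_)
        (Finset.sum_le_sum_of_subset_of_nonneg (fun y hy => ?_) fun y _ _ => by positivity)
      · simp only [Finset.mem_filter, Finset.mem_Ico] at hy
        rw [div_eq_mul_one_div]
        have : ((m + 1 : ℕ) : ℝ) ≤ y := by exact_mod_cast hy.1.2
        gcongr
      · simp only [Finset.mem_filter, Finset.mem_Ico] at hy ⊢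
        omega
    · intro y hy hne
      simp only [Finset.mem_filter, Finset.mem_Ico] at hy
      by_contra hlt
      exact hne (by rw [hf.columnDefect_eq_zero hy.2 (by omega)]; simp)
  refine h1.trans ?_
  rw [← Finset.sum_mul, Finset.sum_Ico_eq_sum_range,
    show 2 * m + L + 2 - (m + 1) = m + L + 1 by omega, ← Nat.cast_sum, hf.sum_columnDefect,
    Nat.cast_sum, Finset.sum_mul, Finset.sum_filter, Finset.sum_filter,
    Finset.sum_Ico_eq_sum_range, show 2 * m + L + 1 - (m + 1) = m + L by omega]
  refine Finset.sum_le_sum fun j hj => ?_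
  rw [Finset.mem_range] at hj
  by_cases h : f m (m + 1 + j) < m
  · rw [if_neg (not_not.2 h), if_neg (by simp [h])]
  · rw [if_pos h, if_pos ⟨by omega, h⟩, mul_left_comm]
    have h2 := hf.openCount_le_midCount (show 3 * L ≤ m + 1 + j by omega) (by omega) h
    gcongr
    exact one_div_cube_le (by omega) (by omega) (by omega)

theorem summable_totalColumnDefect (hf : IsNimTable f L) :
    Summable fun y : ℕ => (totalColumnDefect f y : ℝ) / (y : ℝ) ^ 3 := by
  have hL := hf.pos
  refine sum_Ico_le_of_summable (fun x => by positivity) (fun n => by positivity)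
    (hf.summable_rowInversions.mul_left 27) (7 * L) fun Y => ⟨2 * Y + L, ?_⟩
  simp only [totalColumnDefect, Nat.cast_sum, Finset.sum_div]
  rw [Finset.sum_comm' (t' := Finset.range Y)
    (s' := fun m => (Finset.Ico (7 * L) Y).filter fun y => m < y)]
  · refine (Finset.sum_le_sum fun m _ => hf.sum_columnDefect_le m (7 * L) Y le_rfl).trans ?_
    rw [Finset.sum_comm' (t' := Finset.range (2 * Y + L))
      (s' := fun n => (Finset.range Y).filter fun m =>
        m < n ∧ n < 2 * m + L + 1 ∧ 3 * L ≤ n ∧ ¬ f m n < m)]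
    · refine Finset.sum_le_sum fun n _ => ?_
      rw [rowInversions, Nat.cast_sum, Finset.sum_mul, Finset.mul_sum]
      refine Finset.sum_le_sum_of_subset_of_nonneg (fun x hx => ?_) fun x _ _ => by positivity
      simp only [Finset.mem_filter, Finset.mem_range] at hx ⊢
      exact ⟨hx.2.1, hx.2.2.2.2⟩
    · intro x n
      simp only [Finset.mem_filter, Finset.mem_range, Finset.mem_Ico]
      omega
  · intro x n
    simp only [Finset.mem_filter, Finset.mem_range, Finset.mem_Ico]
    omega

theorem summable_tripleCount_double (hf : IsNimTable f L) :
    Summable fun x : ℕ =>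
      |(tripleCount f (2 * x) : ℝ) - 4 * tripleCount f x| / (x : ℝ) ^ 3 := by
  obtain ⟨K, hK⟩ := hf.tripleCount_double
  have h1 := hf.summable_totalRowExcess.mul_left 2
  -- The factor `8` converts `(2 * x) ^ 3` to `x ^ 3`.
  have h2 := (hf.summable_totalColumnDefect.comp_injective
    (mul_right_injective₀ (two_ne_zero (α := ℕ)))).mul_left 8
  have h3 := (Real.summable_one_div_nat_pow (p := 2)).2 (by norm_num)
  have h4 := ((Real.summable_one_div_nat_pow (p := 3)).2 (by norm_num)).mul_left K
  rw [← summable_nat_add_iff (3 * L)]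
  refine Summable.of_nonneg_of_le (fun x => by positivity) (fun x => ?_)
    ((summable_nat_add_iff (3 * L)).2 (((h1.add h2).add h3).add h4))
  have hL := hf.pos
  have hx : (0 : ℝ) < ((x + 3 * L : ℕ) : ℝ) := by exact_mod_cast (by omega : 0 < x + 3 * L)
  rw [div_le_iff₀ (by positivity)]
  refine (hK (x + 3 * L) (by omega)).trans (le_of_eq ?_)
  simp only [Function.comp_apply]
  generalize x + 3 * L = y at *
  push_cast
  field_simp
  ring

end IsNimTable

end Summability

/-! ### Counting positions by cells, and the quadratic lower bound. -/

section Counting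

theorem heaps_injective_of_lt {a b c a' b' c' : ℕ} (h1 : a < b) (h2 : b < c) (h1' : a' < b')
    (h2' : b' < c') (h : heaps a b c = heaps a' b' c') : b = b' ∧ c = c' := by
  have hm : ∀ t, t ∈ ({a, b, c} : Multiset ℕ) ↔ t ∈ ({a', b', c'} : Multiset ℕ) := by
    intro t
    rw [← heaps_coe, ← heaps_coe, h]
  simp only [Multiset.insert_eq_cons, Multiset.mem_cons, Multiset.mem_singleton] at hm
  have ha := hm a
  have hb := hm b
  have hc := hm c
  omega

/-- Pairs of middle and greatest heaps, smaller than `N`, of `P`-triples of distinct heaps. -/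
def triplePairs (f : ℕ → ℕ → ℕ) (N : ℕ) : Finset ((_ : ℕ) × ℕ) :=
  (Finset.range N).sigma fun n => (Finset.range n).filter fun m => f m n < m

theorem mem_triplePairs {f : ℕ → ℕ → ℕ} {N : ℕ} {q : (_ : ℕ) × ℕ} :
    q ∈ triplePairs f N ↔ q.1 < N ∧ q.2 < q.1 ∧ f q.2 q.1 < q.2 := by
  simp only [triplePairs, Finset.mem_sigma, Finset.mem_filter, Finset.mem_range]

theorem card_triplePairs (f : ℕ → ℕ → ℕ) (N : ℕ) : (triplePairs f N).card = tripleCount f N := by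
  rw [triplePairs, Finset.card_sigma]
  rfl

theorem numPPositions_eq (F : Finset (Sym ℕ 3)) (N : ℕ) :
    numPPositions F N = Set.ncard {p | ∃ x y z, x ≤ y ∧ y ≤ z ∧ z < N ∧ p = heaps x y z ∧
      PTriple F x y z} := by
  rw [numPPositions, ← Set.ncard_image_of_injective _ Subtype.val_injective]
  congr 1
  ext p
  constructor
  · rintro ⟨⟨p, hp⟩, ⟨hP, hN⟩, rfl⟩
    obtain ⟨x, y, z, hxy, hyz, rfl⟩ := exists_eq_heaps p
    refine ⟨x, y, z, hxy, hyz, hN z ?_, rfl, hp, hP⟩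
    rw [← Sym.mem_coe, heaps_coe]
    simp
  · rintro ⟨x, y, z, hxy, hyz, hz, rfl, hp, hP⟩
    refine ⟨⟨_, hp⟩, ⟨hP, fun a ha => ?_⟩, rfl⟩
    rw [← Sym.mem_coe, heaps_coe] at ha
    simp only [Multiset.insert_eq_cons, Multiset.mem_cons, Multiset.mem_singleton] at ha
    omega

/-- A position with a repeated heap `x` is determined by `x`, which accounts for the extra `N`. -/
theorem numPPositions_mem_Icc {F : Finset (Sym ℕ 3)} {f : ℕ → ℕ → ℕ}
    (hf : ∀ x y z, PTriple F x y z ↔ f x y = z) (N : ℕ) :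
    tripleCount f N ≤ numPPositions F N ∧ numPPositions F N ≤ tripleCount f N + N := by
  classical
  rw [numPPositions_eq, ← card_triplePairs]
  set A : Set (Sym ℕ 3) := {p | ∃ x y z, x ≤ y ∧ y ≤ z ∧ z < N ∧ p = heaps x y z ∧
    PTriple F x y z} with hA
  set φ : ((_ : ℕ) × ℕ) → Sym ℕ 3 := fun q => heaps (f q.2 q.1) q.2 q.1 with hφ
  have hP : ∀ m n, PTriple F (f m n) m n := fun m n =>
    pTriple_swap₁₂.1 (pTriple_swap₂₃.1 ((hf m n _).2 rfl))
  have hsub : A ⊆ ((triplePairs f N).image φ ∪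
      (Finset.range N).image fun x => heaps x x (f x x) : Finset (Sym ℕ 3)) := by
    rintro p ⟨x, y, z, hxy, hyz, hz, rfl, hp⟩
    rw [Finset.mem_coe, Finset.mem_union, Finset.mem_image, Finset.mem_image]
    have hp' : PTriple F y z x := pTriple_swap₂₃.1 (pTriple_swap₁₂.1 hp)
    have h1 := (hf _ _ _).1 hp
    have h2 := (hf _ _ _).1 hp'
    rcases hxy.eq_or_lt with rfl | hxy
    · exact Or.inr ⟨x, Finset.mem_range.2 (by omega), by rw [h1]⟩
    rcases hyz.eq_or_lt with rfl | hyz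
    · exact Or.inr ⟨y, Finset.mem_range.2 hz, by rw [h2, heaps_swap₂₃, heaps_swap₁₂]⟩
    · refine Or.inl ⟨⟨z, y⟩, mem_triplePairs.2 ⟨hz, hyz, ?_⟩, ?_⟩
      · rw [h2]
        exact hxy
      · simp only [hφ, h2]
  constructor
  · rw [← Finset.card_image_of_injOn (f := φ), ← Set.ncard_coe_finset]
    · refine Set.ncard_le_ncard ?_ ((Finset.finite_toSet _).subset hsub)
      intro p hp
      rw [Finset.mem_coe, Finset.mem_image] at hp
      obtain ⟨q, hq, rfl⟩ := hp
      obtain ⟨h1, h2, h3⟩ := mem_triplePairs.1 hq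
      exact ⟨_, _, _, h3.le, h2.le, h1, rfl, hP _ _⟩
    · intro q hq r hr h
      obtain ⟨-, h2, h3⟩ := mem_triplePairs.1 hq
      obtain ⟨-, h2', h3'⟩ := mem_triplePairs.1 hr
      obtain ⟨e1, e2⟩ := heaps_injective_of_lt h3 h2 h3' h2' h
      cases q
      cases r
      simp only at e1 e2
      rw [e1, e2]
  · refine (Set.ncard_le_ncard hsub (Finset.finite_toSet _)).trans ?_
    rw [Set.ncard_coe_finset]
    refine (Finset.card_union_le _ _).trans (add_le_add Finset.card_image_le ?_)
    exact Finset.card_image_le.trans (Finset.card_range N).le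

theorem abs_tripleCount_succ_sub_le (f : ℕ → ℕ → ℕ) (x : ℕ) :
    |(tripleCount f (x + 1) : ℝ) - tripleCount f x| ≤ 1 * (x + 1) := by
  have h : (midCount f x x : ℝ) ≤ x := by exact_mod_cast midCount_le f x x
  rw [tripleCount, Finset.sum_range_succ, ← tripleCount, Nat.cast_add, add_sub_cancel_left,
    abs_of_nonneg (Nat.cast_nonneg _)]
  linarith

namespace IsNimTable

variable {f : ℕ → ℕ → ℕ} {L : ℕ}

/-- A triple with middle heap below `x` has its greatest heap below `2 * x + L`. -/
theorem sum_openCount_le (hf : IsNimTable f L) (x : ℕ) :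
    ∑ m ∈ Finset.range x, openCount f m (m + 1) ≤ tripleCount f (2 * x + L) := by
  rw [hf.sum_openCount, totalRowExcess, add_assoc, ← Finset.sum_add_distrib, tripleCount, tripleCount,
    ← Finset.sum_range_add_sum_Ico _ (show x ≤ 2 * x + L by omega)]
  refine Nat.add_le_add_left (Finset.sum_le_sum fun n hn => ?_) _
  rw [Finset.mem_Ico] at hn
  have h := sub_card_filter_not_le (fun m => f m n < m) hn.1
  rw [card_not_mid] at h
  have h2 := midCount_mono (f := f) n hn.1
  rw [rowExcess]
  unfold midCount at *
  omega

theorem exists_sq_le_tripleCount (hf : IsNimTable f L) :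
    ∃ N₀ : ℕ, ∀ N ≥ N₀, (N : ℝ) ^ 2 / 192 ≤ tripleCount f N := by
  obtain ⟨K, hK⟩ := hf.sum_openCount_approx
  obtain ⟨X, hX⟩ := exists_nat_ge (max K 0)
  refine ⟨2 * L + 4 * X + 40, fun N hN => ?_⟩
  obtain ⟨x, h1, h2⟩ : ∃ x, 2 * x + L ≤ N ∧ N ≤ 2 * x + L + 1 := ⟨(N - L) / 2, by omega, by omega⟩
  have hmono : tripleCount f (2 * x + L) ≤ tripleCount f N :=
    Finset.sum_le_sum_of_subset (Finset.range_mono h1)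
  have hmono' : tripleCount f x ≤ tripleCount f N :=
    Finset.sum_le_sum_of_subset (Finset.range_mono (by omega))
  have h3 : ((∑ m ∈ Finset.range x, openCount f m (m + 1) : ℕ) : ℝ) ≤ tripleCount f N := by
    exact_mod_cast (hf.sum_openCount_le x).trans hmono
  have h4 : (tripleCount f x : ℝ) ≤ tripleCount f N := by exact_mod_cast hmono'
  have h5 := (abs_le.1 (hK x)).1
  have h6 : K ≤ x := (le_max_left K 0).trans (hX.trans (by exact_mod_cast (by omega : X ≤ x)))
  have h7 : (N : ℝ) ≤ 4 * x := by exact_mod_cast (by omega : N ≤ 4 * x)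
  have h8 : (10 : ℝ) ≤ x := by exact_mod_cast (by omega : 10 ≤ x)
  have h9 : (N : ℝ) ^ 2 ≤ (4 * x) ^ 2 := by gcongr
  -- With `T = tripleCount f N`: `3 * T ≥ x ^ 2 / 2 - 5 * x / 2 ≥ x ^ 2 / 4 ≥ N ^ 2 / 64`, using `x
  -- ≥ 10` and `N ≤ 4 * x`.
  nlinarith

end IsNimTable

end Counting

/-! ### Assembly of the limit. -/

theorem theorem6p1 (F : Finset (Sym ℕ 3)) (n : ℕ) (hn : 0 < n) :
    ∃ L : ℝ, L ≠ 0 ∧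
      Tendsto (fun k : ℕ => (numPPositions F (n * 2 ^ k) : ℝ) / ((n : ℝ) * 2 ^ k) ^ 2)
        atTop (𝓝 L) := by
  obtain ⟨f, B, hf, hfF⟩ := exists_isNimTable F
  obtain ⟨l, hl⟩ := exists_tendsto_of_summable_doubling
    (T := fun x => (tripleCount f x : ℝ)) zero_le_one
    (abs_tripleCount_succ_sub_le f) hf.summable_tripleCount_double hn
  have hn' : (0 : ℝ) < n := by exact_mod_cast hn
  have h4 : ∀ k : ℕ, ((n : ℝ) * 2 ^ k) ^ 2 = n ^ 2 * 4 ^ k := fun k => by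
    rw [mul_pow, ← pow_mul, mul_comm k 2, pow_mul]
    norm_num
  have hlim : Tendsto (fun k : ℕ => (tripleCount f (n * 2 ^ k) : ℝ) / ((n : ℝ) * 2 ^ k) ^ 2)
      atTop (𝓝 (l / n ^ 2)) := by
    refine (hl.div_const ((n : ℝ) ^ 2)).congr fun k => ?_
    rw [h4, div_div, mul_comm ((4 : ℝ) ^ k)]
  have hpow : Tendsto (fun k : ℕ => n * 2 ^ k) atTop atTop :=
    tendsto_atTop_mono (fun k => (Nat.lt_two_pow_self).le.trans (Nat.le_mul_of_pos_left _ hn))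
      tendsto_id
  have herr : Tendsto (fun k : ℕ => (((n * 2 ^ k : ℕ) : ℝ))⁻¹) atTop (𝓝 0) :=
    (tendsto_inv_atTop_nhds_zero_nat (𝕜 := ℝ)).comp hpow
  obtain ⟨N₀, hN₀⟩ := hf.exists_sq_le_tripleCount
  refine ⟨l / n ^ 2, ?_, ?_⟩
  · refine (lt_of_lt_of_le (by norm_num : (0 : ℝ) < 1 / 192)
      (ge_of_tendsto hlim ((hpow.eventually_ge_atTop N₀).mono fun k hk => ?_))).ne'
    have h := hN₀ _ hk
    rw [le_div_iff₀ (by positivity)]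
    push_cast at h
    linarith
  · have hup := hlim.add herr
    rw [add_zero] at hup
    refine tendsto_of_tendsto_of_tendsto_of_le_of_le hlim hup (fun k => ?_) fun k => ?_
    · have h : (tripleCount f (n * 2 ^ k) : ℝ) ≤ numPPositions F (n * 2 ^ k) := by
        exact_mod_cast (numPPositions_mem_Icc hfF _).1
      dsimp only
      gcongr
    · have h : (numPPositions F (n * 2 ^ k) : ℝ) ≤ tripleCount f (n * 2 ^ k) + n * 2 ^ k := by
        exact_mod_cast (numPPositions_mem_Icc hfF _).2
      dsimp only
      rw [div_le_iff₀ (by positivity), add_mul, div_mul_cancel₀ _ (by positivity)]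
      refine h.trans (le_of_eq ?_)
      push_cast
      field_simp
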